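/- Let $d\in\mathbb N$, $K(x,y)=x^\top y+1$ on $\mathbb R^d\times\mathbb R^d$, and let $V:\mathbb R^d\to\mathbb R$ satisfy the following two assumptions (Euclidean norm for vectors, spectral norm for matrices). (A1) $V\in C^\infty(\mathbb R^d)$, $V\ge 0$, $V(x)\to\infty$ as $\|x\|\to\infty$; and for all $\alpha,\beta>0$ there is $C_{\alpha,\beta}>0$ such that, whenever $\|y\|\le\alpha\|x\|+\beta$, $$(1+\|x\|)\,\|\nabla V(y)\|+(1+\|x\|)^2\,\|\nabla^2V(y)\|\le C_{\alpha,\beta}(1+V(x)).$$ (A2) There are $q>1$ and $C_V>0$ such that $\|\nabla V(x)\|^q\le C_V(1+V(x))$ for all $x$, and, for all $(x,y)\ne(0,0)$, $$\sup_{\theta\in[0,1]}\|\nabla^2V(\theta x+(1-\theta)y)\|^q\le C_V\Big(1+\frac{V(x)+V(y)}{(\|x\|+\|y\|)^q}\Big).$$ Consider the SVGD mean-field equation $\partial_t\rho_t=\nabla\cdot\big(\rho_t(x)\int K(x,y)(\nabla\rho_t(y)+\rho_t(y)\nabla V(y))\,dy\big)$, that is, $\partial_t\rho_t+\nabla\cdot(\rho_tU[\rho_t])=0$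 with $$U[\rho](x)=\int\nabla_yK(x,y)\,\rho(dy)-\int K(x,y)\nabla V(y)\,\rho(dy)=x-\int(x^\top y+1)\nabla V(y)\,\rho(dy).$$ A weak solution with initial condition $\nu$ is a narrowly continuous curve $(\mu_t)_{t\ge0}$ of probability measures on $\mathbb R^d$ with $\mu_0=\nu$, with $\sup_{t\in[0,T]}\int(1+V)\,d\mu_t<\infty$ for all $T>0$, and with $$\int_0^\infty\!\!\int\big(\partial_t\phi(t,x)+\nabla\phi(t,x)^\top U[\mu_t](x)\big)\,\mu_t(dx)\,dt+\int\phi(0,x)\,\nu(dx)=0$$ for all $\phi\in C_c^\infty([0,\infty)\times\mathbb R^d)$ (not required to vanish at $t=0$). Let $p$ be a real number with $p\ge q/(q-1)$, write $\|\nu\|_{\mathcal P^p}=\int\|x\|^p\,d\nu$, and let $\mathcal W_p$ be the $p$-Wasserstein distance. Then: 1. For all $R,T>0$ there is a constant $C_T>0$, depending only on $V$ (with $d$, $q$, $p$), $R$ and $T$, such that for any probability measures $\nu_1,\nu_2$ with $\|\nu_i\|_{\mathcal P^p}\le R$ and any weak solutions $\mu_{1,t},\mu_{2,t}$ with initial conditions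 $\nu_1,\nu_2$, $$\sup_{t\in[0,T]}\mathcal W_p(\mu_{1,t},\mu_{2,t})\le C_T\,\mathcal W_p(\nu_1,\nu_2).$$ 2. Consequently, if $\|\nu\|_{\mathcal P^p}<\infty$, $\mu_t$ is a weak solution with initial condition $\nu$, and $\nu_n=\frac1{N_n}\sum_{i=1}^{N_n}\delta_{x_i^{(n)}}$ are empirical measures with $\mathcal W_p(\nu_n,\nu)\to0$, then weak solutions $\mu_{n,t}$ with initial conditions $\nu_n$ satisfy $\sup_{t\in[0,T]}\mathcal W_p(\mu_{n,t},\mu_t)\to0$ for every $T>0$. -/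

import Mathlib

open MeasureTheory Filter Topology Set
open scoped ENNReal ContDiff

namespace SVGD

/-- Euclidean space `ℝ^d`. -/
abbrev Space (d : ℕ) : Type := EuclideanSpace ℝ (Fin d)

/-- The simple bilinear kernel `K(x, y) = xᵀ y + 1`. -/
noncomputable def bilinearKernel {d : ℕ} (x y : Space d) : ℝ :=
  inner ℝ x y + 1

/-- The Hessian `∇²V(x)` as a linear operator; its operator norm is the spectral norm. -/
noncomputable def hessian {d : ℕ} (V : Space d → ℝ) (x : Space d) : Space d →L[ℝ] Space d :=
  fderiv ℝ (gradient V) x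

/-- First assumption on the potential: smooth, nonnegative, coercive, with a growth control of
the gradient and of the Hessian. -/
structure GrowthAssumption {d : ℕ} (V : Space d → ℝ) : Prop where
  smooth : ContDiff ℝ ∞ V
  nonneg : ∀ x, 0 ≤ V x
  coercive : Tendsto V (Bornology.cobounded (Space d)) atTop
  growth : ∀ α β : ℝ, 0 < α → 0 < β → ∃ C : ℝ, 0 < C ∧
    ∀ x y : Space d, ‖y‖ ≤ α * ‖x‖ + β →
      (1 + ‖x‖) * ‖gradient V y‖ + (1 + ‖x‖) ^ 2 * ‖hessian V y‖ ≤ C * (1 + V x)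

/-- Second assumption on the potential, with index `q`. In the bound on the Hessian the pair
`x = y = 0`, where the right-hand side is not defined, is left out. -/
def IndexAssumption {d : ℕ} (V : Space d → ℝ) (q : ℝ) : Prop :=
  1 < q ∧ ∃ C : ℝ, 0 < C ∧
    (∀ x : Space d, ‖gradient V x‖ ^ q ≤ C * (1 + V x)) ∧
    (∀ x y : Space d, (x ≠ 0 ∨ y ≠ 0) → ∀ θ ∈ Icc (0 : ℝ) 1,
      ‖hessian V (θ • x + (1 - θ) • y)‖ ^ q ≤ C * (1 + (V x + V y) / (‖x‖ + ‖y‖) ^ q))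

/-- `‖μ‖_{P_V} = ∫ (1 + V) dμ`, as an extended nonnegative number (used for `V ≥ 0`). -/
noncomputable def potentialNorm {d : ℕ} (V : Space d → ℝ) (μ : Measure (Space d)) : ℝ≥0∞ :=
  ∫⁻ x, ENNReal.ofReal (1 + V x) ∂μ

/-- `‖μ‖_{P^p} = ∫ ‖x‖^p dμ` (no root is taken), as an extended nonnegative number. -/
noncomputable def momentNorm {d : ℕ} (p : ℝ) (μ : Measure (Space d)) : ℝ≥0∞ :=
  ∫⁻ x, ‖x‖ₑ ^ p ∂μ

/-- The set of couplings of two measures. -/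
def couplings {d : ℕ} (μ ν : Measure (Space d)) : Set (Measure (Space d × Space d)) :=
  {π | π.map Prod.fst = μ ∧ π.map Prod.snd = ν}

/-- The `p`-Wasserstein distance for the Euclidean norm. -/
noncomputable def wasserstein {d : ℕ} (p : ℝ) (μ ν : Measure (Space d)) : ℝ≥0∞ :=
  (⨅ π ∈ couplings μ ν, ∫⁻ z, ‖z.1 - z.2‖ₑ ^ p ∂π) ^ (1 / p)

/-- The velocity field of the mean-field equation
`∂ₜρ = ∇ · (ρ(x) ∫ K(x, y) (∇ρ(y) + ρ(y) ∇V(y)) dy)`, written as `∂ₜρ + ∇ · (ρ U[ρ]) = 0`. After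
integrating by parts in `y`, it makes sense for measures:
`U[ρ](x) = ∫ ∇_y K(x, y) dρ(y) - ∫ K(x, y) ∇V(y) dρ(y)`. -/
noncomputable def velocity {d : ℕ} (V : Space d → ℝ) (ρ : Measure (Space d)) (x : Space d) :
    Space d :=
  (∫ y, gradient (fun z => bilinearKernel x z) y ∂ρ)
    - ∫ y, bilinearKernel x y • gradient V y ∂ρ

/-- `μ` (restricted to times `t ≥ 0`) is a weak solution of the mean-field equation with initial
condition `ν`: a narrowly continuous curve of probability measures, with `P_V`-norm locally
bounded in time, that satisfies the equation against every smooth compactly supported test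
function on `[0, ∞) × ℝ^d` (not required to vanish at `t = 0`). -/
structure IsWeakSolution {d : ℕ} (V : Space d → ℝ) (ν : Measure (Space d))
    (μ : ℝ → ProbabilityMeasure (Space d)) : Prop where
  continuousOn : ContinuousOn μ (Ici 0)
  initial : (μ 0 : Measure (Space d)) = ν
  bounded : ∀ T : ℝ, 0 < T → (⨆ t ∈ Icc (0 : ℝ) T, potentialNorm V (μ t)) < ⊤
  equation : ∀ φ : ℝ × Space d → ℝ, ContDiff ℝ ∞ φ → HasCompactSupport φ →
    (∫ t in Ioi (0 : ℝ), ∫ x,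
        (deriv (fun s => φ (s, x)) t
          + inner ℝ (gradient (fun z => φ (t, z)) x) (velocity V (μ t) x)) ∂(μ t : Measure (Space d)))
      + ∫ x, φ (0, x) ∂ν = 0

/-- The empirical measure `(1/N) ∑ δ_{x i}` of `N` points. -/
noncomputable def empiricalMeasure {d N : ℕ} (x : Fin N → Space d) : Measure (Space d) :=
  (N : ℝ≥0∞)⁻¹ • ∑ i, Measure.dirac (x i)

end SVGD

/-!
For the kernel `K(x, y) = xᵀ y + 1` the velocity field of a measure `ρ` is affine in space:
`U[ρ](x) = L x + c` with `L = I - ∫ ∇V(y) yᵀ dρ(y)` and `c = -∫ ∇V dρ` (`velocity_eq`). Weak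
solutions are therefore transported by affine flows, which solve linear differential equations, and
the stability estimate is Gronwall's lemma for the coefficients of these flows.

*Transport by the flow.* The weak formulation extends from compactly supported functions to smooth
`f` with `|f|` and `(1 + ‖x‖) ‖∇f‖` bounded by a multiple of `1 + V`
(`IsWeakSolution.sub_eq_integral_rate`). With `f = V` this makes `t ↦ ∫ V dμ_t` continuous, hence
`V` is uniformly integrable along the curve and the coefficients `L_t`, `c_t` of `U[μ_t]` are
continuous in time. The affine flow `x ↦ A_t x + a_t` of `L_t x + c_t` and its inverse `Ψ_t` exist
globally (`exists_affine_flow`), and `∫ ψ(Ψ_t x) dμ_t(x)` has derivative zero for every test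
function `ψ`; so `μ_t` is the image of `ν` under the flow (`IsWeakSolution.exists_flow`).

*Energy estimate.* In `d/dt ∫ V dμ_t = ∫ ⟪∇V, U[μ_t]⟫ dμ_t` the interaction contributes minus a sum
of squares, as the kernel is positive, and what remains is at most `C ∫ (1 + V) dμ_t`
(`rate_potential_le`). The bound `‖∇V‖^q ≤ C (1 + V)` says that `(1 + V)^{1 - 1/q}` is Lipschitz
(`exists_rpow_le`), so that `1 + V ≤ C (1 + ‖x‖^p)` because `p ≥ q / (q - 1)`. Thus
`∫ (1 + V) dμ_t` is bounded on `[0, T]` in terms of `R` and `T` only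
(`exists_integral_potential_le`).

*Stability.* The growth assumption on the Hessian and `(1 + V)^{1 - 1/q} ≤ C (1 + ‖x‖)` together
show that `∇V` and `∇V(y) yᵀ` are locally Lipschitz with a constant of order `(1 + V)^{1/q}`
(`exists_lipschitz_gradient`). The conjugate exponent of `p` is at most `q`, so Hölder's inequality
bounds the difference of the coefficients `L`, `c` of two measures by the `L^p` cost of any coupling
(`exists_velocity_sub_le`). A coupling `π` of the initial conditions is transported by the two
flows; its cost at time `t` is at most a multiple of the initial cost plus the distance of the
coefficients of the flows (`lintegral_affine_sub_le`), and Gronwall's lemma closes the estimate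
(`exists_wasserstein_le_of_coupling`). The infimum over `π` gives the first claim. For the second,
`p`-th moments of measures at distance less than one from `ν` are bounded uniformly
(`momentNorm_le_of_wasserstein_lt_one`), so the first claim applies with a fixed constant.
-/

namespace SVGD

/-! ### Linear differential equations -/

/-- Global existence for `Y' = 𝓛 t Y`, with continuous bounded coefficients. The Picard operator is
a contraction for the norm `sup_t e^{-(2K+1)t} ‖Y t‖`. -/
theorem exists_solution_linear_ode {E : Type*} [NormedAddCommGroup E] [NormedSpace ℝ E]
    [CompleteSpace E] {𝓛 : ℝ → E →L[ℝ] E} (h𝓛 : Continuous 𝓛) {K : ℝ} (hK : ∀ t, ‖𝓛 t‖ ≤ K)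
    (x₀ : E) : ∃ Y : ℝ → E, Y 0 = x₀ ∧ Continuous Y ∧
      ∀ t, 0 ≤ t → HasDerivAt Y (𝓛 t (Y t)) t := by
  have hK0 : 0 ≤ K := (norm_nonneg _).trans (hK 0)
  set l : ℝ := 2 * K + 1 with hl
  have hl0 : 0 < l := by positivity
  have hcont : ∀ X : BoundedContinuousFunction ℝ E,
      Continuous fun s => Real.exp (l * s) • 𝓛 s (X s) := fun X => by
    have := X.continuous
    fun_prop
  have hint : ∀ X : BoundedContinuousFunction ℝ E, ∀ a b,
      IntervalIntegrable (fun s => Real.exp (l * s) • 𝓛 s (X s)) volume a b :=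
    fun X a b => (hcont X).intervalIntegrable a b
  have hprim : ∀ X : BoundedContinuousFunction ℝ E,
      Continuous fun t => ∫ s in (0 : ℝ)..t, Real.exp (l * s) • 𝓛 s (X s) := fun X =>
    intervalIntegral.continuous_primitive (hint X) 0
  have hbound : ∀ X : BoundedContinuousFunction ℝ E, ∀ t, 0 ≤ t →
      ‖Real.exp (-(l * t)) • ∫ s in (0 : ℝ)..t, Real.exp (l * s) • 𝓛 s (X s)‖ ≤ ‖X‖ / 2 := by
    intro X t ht
    have h1 : ‖∫ s in (0 : ℝ)..t, Real.exp (l * s) • 𝓛 s (X s)‖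
        ≤ ∫ s in (0 : ℝ)..t, (K * ‖X‖) * Real.exp (l * s) := by
      refine intervalIntegral.norm_integral_le_of_norm_le ht (Eventually.of_forall fun s _ => ?_)
        (Continuous.intervalIntegrable (by fun_prop) _ _)
      rw [norm_smul, Real.norm_eq_abs, abs_of_pos (Real.exp_pos _), mul_comm]
      gcongr
      exact ((𝓛 s).le_opNorm _).trans (mul_le_mul (hK s) (X.norm_coe_le_norm s) (norm_nonneg _) hK0)
    have h2 : ∫ s in (0 : ℝ)..t, (K * ‖X‖) * Real.exp (l * s)
        = (K * ‖X‖) * ((Real.exp (l * t) - 1) / l) := by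
      rw [intervalIntegral.integral_const_mul]
      congr 1
      have : ∀ s ∈ uIcc 0 t, HasDerivAt (fun s => Real.exp (l * s) / l) (Real.exp (l * s)) s := by
        intro s _
        have := (((hasDerivAt_id s).const_mul l).exp).div_const l
        simpa [hl0.ne'] using this
      rw [intervalIntegral.integral_eq_sub_of_hasDerivAt this
        (Continuous.intervalIntegrable (by fun_prop) _ _)]
      simp [sub_div]
    rw [norm_smul, Real.norm_eq_abs, abs_of_pos (Real.exp_pos _)]
    calc _ ≤ Real.exp (-(l * t)) * ((K * ‖X‖) * ((Real.exp (l * t) - 1) / l)) := by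
          rw [← h2]; gcongr
      _ = (K / l * ‖X‖) * (1 - Real.exp (-(l * t))) := by
          rw [Real.exp_neg]
          field_simp
      _ ≤ (1 / 2 * ‖X‖) * 1 := by
          have hKl : K / l ≤ 1 / 2 := by
            rw [div_le_div_iff₀ hl0 two_pos]; linarith
          have hexp : Real.exp (-(l * t)) ≤ 1 := Real.exp_le_one_iff.2 (by simp; positivity)
          exact mul_le_mul (mul_le_mul_of_nonneg_right hKl (norm_nonneg _))
            (by linarith [Real.exp_pos (-(l * t))]) (by linarith) (by positivity)
      _ = ‖X‖ / 2 := by ring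
  let P : BoundedContinuousFunction ℝ E → BoundedContinuousFunction ℝ E := fun X =>
    BoundedContinuousFunction.ofNormedAddCommGroup
      (fun t => Real.exp (-(l * max t 0)) • x₀ + Real.exp (-(l * max t 0)) •
        ∫ s in (0 : ℝ)..max t 0, Real.exp (l * s) • 𝓛 s (X s))
      (by
        have := (hprim X).comp (f := fun t : ℝ => max t 0) (by fun_prop)
        simp only [Function.comp_def] at this
        fun_prop)
      (‖x₀‖ + ‖X‖ / 2)
      (by
        intro t
        refine (norm_add_le _ _).trans (add_le_add ?_ (hbound X _ (le_max_right _ _)))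
        rw [norm_smul, Real.norm_eq_abs, abs_of_pos (Real.exp_pos _)]
        refine mul_le_of_le_one_left (norm_nonneg _) (Real.exp_le_one_iff.2 ?_)
        have : 0 ≤ max t 0 := le_max_right _ _
        simp only [Left.neg_nonpos_iff]; positivity)
  have hP : ContractingWith (1 / 2) P := by
    refine ⟨by rw [← NNReal.coe_lt_coe]; norm_num, LipschitzWith.of_dist_le_mul fun X Z => ?_⟩
    refine (BoundedContinuousFunction.dist_le (by positivity)).2 fun t => ?_
    have h := hbound (X - Z) (max t 0) (le_max_right _ _)
    have h3 : (∫ s in (0 : ℝ)..max t 0, Real.exp (l * s) • 𝓛 s ((X - Z) s))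
        = (∫ s in (0 : ℝ)..max t 0, Real.exp (l * s) • 𝓛 s (X s))
          - ∫ s in (0 : ℝ)..max t 0, Real.exp (l * s) • 𝓛 s (Z s) := by
      rw [← intervalIntegral.integral_sub (hint X _ _) (hint Z _ _)]
      simp [smul_sub]
    rw [h3, smul_sub] at h
    rw [dist_eq_norm, dist_eq_norm]
    simp only [P, BoundedContinuousFunction.coe_ofNormedAddCommGroup, add_sub_add_left_eq_sub]
    refine h.trans (le_of_eq ?_)
    norm_num
    ring
  set X := ContractingWith.fixedPoint P hP
  have hX : P X = X := hP.fixedPoint_isFixedPt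
  refine ⟨fun t => x₀ + ∫ s in (0 : ℝ)..t, Real.exp (l * s) • 𝓛 s (X s), by simp,
    continuous_const.add (hprim X), fun t ht => ?_⟩
  have h4 : X t = Real.exp (-(l * t)) • (x₀ + ∫ s in (0 : ℝ)..t, Real.exp (l * s) • 𝓛 s (X s)) := by
    conv_lhs => rw [← hX]
    simp only [P, BoundedContinuousFunction.coe_ofNormedAddCommGroup, max_eq_left ht, smul_add]
  have h5 := (intervalIntegral.integral_hasDerivAt_right (hint X 0 t)
    ((hcont X).stronglyMeasurableAtFilter _ _) (hcont X).continuousAt).const_add x₀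
  convert h5 using 1
  conv_rhs => rw [h4]
  rw [map_smul, smul_smul, ← Real.exp_add]
  simp

/-- The fundamental solution `A` of `x' = L x`, its inverse `B`, and the shifts `a`, `b` of the
affine flow `x ↦ A x + a` of `x' = L x + c` and of its inverse `x ↦ B x + b`. -/
theorem exists_affine_flow {E : Type*} [NormedAddCommGroup E] [NormedSpace ℝ E]
    [FiniteDimensional ℝ E] {L : ℝ → E →L[ℝ] E} (hL : Continuous L) {K : ℝ}
    (hK : ∀ t, ‖L t‖ ≤ K) {c : ℝ → E} (hc : Continuous c) :
    ∃ (A B : ℝ → E →L[ℝ] E) (a b : ℝ → E),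
      Continuous A ∧ Continuous B ∧ Continuous a ∧ Continuous b ∧
      A 0 = 1 ∧ B 0 = 1 ∧ a 0 = 0 ∧ b 0 = 0 ∧
      (∀ t, 0 ≤ t → HasDerivAt A (L t * A t) t) ∧
      (∀ t, 0 ≤ t → HasDerivAt B (-(B t * L t)) t) ∧
      (∀ t, 0 ≤ t → HasDerivAt a (L t (a t) + c t) t) ∧
      (∀ t, HasDerivAt b (-B t (c t)) t) ∧
      (∀ t, 0 ≤ t → ∀ x, B t (A t x + a t) + b t = x) ∧
      (∀ t, 0 ≤ t → ∀ x, A t (B t x + b t) + a t = x) := by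
  have : CompleteSpace E := FiniteDimensional.complete ℝ E
  obtain ⟨A, hA0, hAc, hA⟩ := exists_solution_linear_ode (E := E →L[ℝ] E)
    (𝓛 := fun t => ContinuousLinearMap.mul ℝ (E →L[ℝ] E) (L t)) (by fun_prop) (K := K)
    (fun t => (ContinuousLinearMap.opNorm_mul_apply_le ℝ _ _).trans (hK t)) 1
  obtain ⟨B, hB0, hBc, hB⟩ := exists_solution_linear_ode (E := E →L[ℝ] E)
    (𝓛 := fun t => -(ContinuousLinearMap.mul ℝ (E →L[ℝ] E)).flip (L t)) (by fun_prop) (K := K)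
    (fun t => by
      rw [norm_neg]
      refine (ContinuousLinearMap.opNorm_le_bound _ (norm_nonneg (L t)) fun X => ?_).trans (hK t)
      rw [ContinuousLinearMap.flip_apply, ContinuousLinearMap.mul_apply', mul_comm ‖L t‖]
      exact norm_mul_le _ _) 1
  have hA' : ∀ t, 0 ≤ t → HasDerivAt A (L t * A t) t := hA
  have hB' : ∀ t, 0 ≤ t → HasDerivAt B (-(B t * L t)) t := hB
  have hBA : ∀ t, 0 ≤ t → B t * A t = 1 := by
    intro t ht
    have h1 := constant_of_has_deriv_right_zero (f := fun s => B s * A s) (a := 0) (b := t)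
      (hBc.mul hAc).continuousOn (fun s hs => by
        have h2 : HasDerivWithinAt (fun s => B s * A s) _ (Ici s) s :=
          ((hB' s hs.1).mul (hA' s hs.1)).hasDerivWithinAt
        exact h2.congr_deriv (by rw [neg_mul, mul_assoc, neg_add_cancel])) t ⟨ht, le_rfl⟩
    simpa [hA0, hB0] using h1
  have hAB : ∀ t, 0 ≤ t → A t * B t = 1 := by
    intro t ht
    have h1 : (B t : E →ₗ[ℝ] E) * (A t : E →ₗ[ℝ] E) = 1 :=
      LinearMap.ext fun x => by simpa using congrArg (fun F : E →L[ℝ] E => F x) (hBA t ht)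
    have h2 := (mul_eq_one_comm).1 h1
    exact ContinuousLinearMap.ext fun x => by
      simpa using congrArg (fun F : E →ₗ[ℝ] E => F x) h2
  have hABx : ∀ t, 0 ≤ t → ∀ x, A t (B t x) = x := fun t ht x => by
    simpa using congrArg (fun F : E →L[ℝ] E => F x) (hAB t ht)
  have hBAx : ∀ t, 0 ≤ t → ∀ x, B t (A t x) = x := fun t ht x => by
    simpa using congrArg (fun F : E →L[ℝ] E => F x) (hBA t ht)
  have hBcc : Continuous fun t => B t (c t) := hBc.clm_apply hc
  let b : ℝ → E := fun t => -∫ s in (0 : ℝ)..t, B s (c s)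
  have hb : ∀ t, HasDerivAt b (-B t (c t)) t := fun t =>
    (intervalIntegral.integral_hasDerivAt_right (hBcc.intervalIntegrable _ _)
      (hBcc.stronglyMeasurableAtFilter _ _) hBcc.continuousAt).neg
  have hbc : Continuous b := continuous_iff_continuousAt.2 fun t => (hb t).continuousAt
  refine ⟨A, B, fun t => -A t (b t), b, hAc, hBc, (hAc.clm_apply hbc).neg, hbc, hA0, hB0,
    by simp [b], by simp [b], hA', hB', fun t ht => ?_, hb, fun t ht x => ?_, fun t ht x => ?_⟩
  · have h1 : HasDerivAt (fun t => -A t (b t)) _ t := ((hA' t ht).clm_apply (hb t)).neg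
    exact h1.congr_deriv (by simp [hABx t ht, add_comm])
  · simp [hBAx t ht]
  · simp [hABx t ht]

/-! ### Growth and regularity of the potential -/

section
variable {d : ℕ} {V : Space d → ℝ}

/-- The rank-one operator `v ↦ ⟪y, v⟫ ∇V(y)`, whose mean is the linear part of the velocity. -/
noncomputable def gradientOuter (V : Space d → ℝ) (y : Space d) : Space d →L[ℝ] Space d :=
  (innerSL ℝ y).smulRight (gradient V y)

theorem gradientOuter_apply (y v : Space d) :
    gradientOuter V y v = inner ℝ y v • gradient V y := rfl

theorem norm_gradientOuter (y : Space d) : ‖gradientOuter V y‖ = ‖y‖ * ‖gradient V y‖ := by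
  rw [gradientOuter, ContinuousLinearMap.norm_smulRight_apply, innerSL_apply_norm]

theorem norm_gradientOuter_sub_le (x y : Space d) :
    ‖gradientOuter V x - gradientOuter V y‖
      ≤ ‖x - y‖ * ‖gradient V x‖ + ‖y‖ * ‖gradient V x - gradient V y‖ := by
  have h : gradientOuter V x - gradientOuter V y
      = (innerSL ℝ (x - y)).smulRight (gradient V x)
        + (innerSL ℝ y).smulRight (gradient V x - gradient V y) := by
    ext1 v
    simp [gradientOuter, sub_smul, smul_sub]
  rw [h]
  refine (norm_add_le _ _).trans (le_of_eq ?_)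
  simp only [ContinuousLinearMap.norm_smulRight_apply, innerSL_apply_norm]

theorem contDiff_gradient {f : Space d → ℝ} (hf : ContDiff ℝ ∞ f) :
    ContDiff ℝ ∞ (gradient f) := by
  have h : ContDiff ℝ ∞ (fderiv ℝ f) := hf.fderiv_right (by simp)
  exact (InnerProductSpace.toDual ℝ (Space d)).symm.contDiff.comp h

theorem norm_gradient {f : Space d → ℝ} (x : Space d) : ‖gradient f x‖ = ‖fderiv ℝ f x‖ := by
  simp [gradient]

theorem continuous_gradientOuter (hV : ContDiff ℝ ∞ V) : Continuous (gradientOuter V) := by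
  have h := (contDiff_gradient hV).continuous
  refine continuous_clm_apply.2 fun v => ?_
  simp only [gradientOuter_apply]
  fun_prop

/-- The growth assumption at `α = β = 1`, with `y = x`. -/
theorem GrowthAssumption.exists_gradient_le (hV : GrowthAssumption V) :
    ∃ C : ℝ, 0 < C ∧ ∀ x, (1 + ‖x‖) * ‖gradient V x‖ ≤ C * (1 + V x) := by
  obtain ⟨C, hC, h⟩ := hV.growth 1 1 one_pos one_pos
  refine ⟨C, hC, fun x => le_trans ?_ (h x x (by linarith))⟩
  have : 0 ≤ (1 + ‖x‖) ^ 2 * ‖hessian V x‖ := by positivity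
  linarith

/-- The bound `‖∇V‖^q ≤ C (1 + V)` says that `(1 + V)^{1 - 1/q}` is Lipschitz. -/
theorem exists_rpow_le (hV : GrowthAssumption V) {q : ℝ} (hVq : IndexAssumption V q) :
    ∃ C : ℝ, 0 < C ∧ ∀ x, (1 + V x) ^ (1 - 1 / q) ≤ C * (1 + ‖x‖) := by
  obtain ⟨hq, C, hC, hgrad, -⟩ := hVq
  have hq0 : 0 < q := by linarith
  have hw : ∀ x, 0 < 1 + V x := fun x => by linarith [hV.nonneg x]
  have hκ : 0 ≤ 1 - 1 / q := by
    rw [sub_nonneg, div_le_one hq0]; exact hq.le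
  have hκ1 : 1 - 1 / q ≤ 1 := by
    have : 0 < 1 / q := by positivity
    linarith
  have hd : ∀ x, HasFDerivAt (fun x => (1 + V x) ^ (1 - 1 / q))
      (((1 - 1 / q) * (1 + V x) ^ (1 - 1 / q - 1)) • fderiv ℝ V x) x := fun x =>
    ((hV.smooth.differentiable (by simp) x).hasFDerivAt.const_add 1).rpow_const
      (Or.inl (hw x).ne')
  have hb : ∀ x, ‖((1 - 1 / q) * (1 + V x) ^ (1 - 1 / q - 1)) • fderiv ℝ V x‖ ≤ C ^ (1 / q) := by
    intro x
    have h1 : ‖fderiv ℝ V x‖ ≤ C ^ (1 / q) * (1 + V x) ^ (1 / q) := by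
      rw [← norm_gradient, ← Real.mul_rpow hC.le (hw x).le]
      calc ‖gradient V x‖ = (‖gradient V x‖ ^ q) ^ (1 / q) := by
            rw [← Real.rpow_mul (norm_nonneg _), mul_one_div_cancel hq0.ne', Real.rpow_one]
        _ ≤ _ := Real.rpow_le_rpow (by positivity) (hgrad x) (by positivity)
    rw [norm_smul, Real.norm_eq_abs, abs_of_nonneg (mul_nonneg hκ (Real.rpow_nonneg (hw x).le _))]
    calc _ ≤ (1 * (1 + V x) ^ (1 - 1 / q - 1)) * (C ^ (1 / q) * (1 + V x) ^ (1 / q)) := by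
          have := Real.rpow_nonneg (hw x).le (1 - 1 / q - 1)
          gcongr
      _ = C ^ (1 / q) * ((1 + V x) ^ (1 - 1 / q - 1) * (1 + V x) ^ (1 / q)) := by ring
      _ = C ^ (1 / q) := by
          rw [← Real.rpow_add (hw x)]; simp
  refine ⟨C ^ (1 / q) + (1 + V 0) ^ (1 - 1 / q), add_pos (by positivity)
    (Real.rpow_pos_of_pos (hw 0) _), fun x => ?_⟩
  have h2 := convex_univ.norm_image_sub_le_of_norm_hasFDerivWithin_le
    (fun x _ => (hd x).hasFDerivWithinAt) (fun x _ => hb x) (mem_univ 0) (mem_univ x)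
  rw [sub_zero] at h2
  have h3 := (Real.le_norm_self _).trans h2
  have h4 : 0 ≤ C ^ (1 / q) := by positivity
  have h5 := Real.rpow_nonneg (hw 0).le (1 - 1 / q)
  nlinarith [norm_nonneg x]

/-- The exponent `q / (q - 1)` is the inverse of `1 - 1/q`: this is where the lower bound on `p` enters
the growth of `V`. -/
theorem exists_le_moment (hV : GrowthAssumption V) {q : ℝ} (hVq : IndexAssumption V q) {p : ℝ}
    (hp : q / (q - 1) ≤ p) : ∃ C : ℝ, 0 < C ∧ ∀ x, 1 + V x ≤ C * (1 + ‖x‖ ^ p) := by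
  obtain ⟨C, hC, h⟩ := exists_rpow_le hV hVq
  have hq := hVq.1
  have hq1 : 0 < q - 1 := by linarith
  have hq0 : 0 < q := by linarith
  have hp1 : 1 ≤ p := le_trans (by rw [one_le_div hq1]; linarith) hp
  refine ⟨C ^ (q / (q - 1)) * 2 ^ (p - 1), by positivity, fun x => ?_⟩
  have hw : 0 ≤ 1 + V x := by linarith [hV.nonneg x]
  calc 1 + V x = ((1 + V x) ^ (1 - 1 / q)) ^ (q / (q - 1)) := by
        rw [← Real.rpow_mul hw]
        have : (1 - 1 / q) * (q / (q - 1)) = 1 := by field_simp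
        rw [this, Real.rpow_one]
    _ ≤ (C * (1 + ‖x‖)) ^ (q / (q - 1)) :=
        Real.rpow_le_rpow (Real.rpow_nonneg hw _) (h x) (by positivity)
    _ = C ^ (q / (q - 1)) * (1 + ‖x‖) ^ (q / (q - 1)) := Real.mul_rpow hC.le (by positivity)
    _ ≤ C ^ (q / (q - 1)) * (1 + ‖x‖) ^ p := by
        gcongr
        linarith [norm_nonneg x]
    _ ≤ C ^ (q / (q - 1)) * (2 ^ (p - 1) * (1 ^ p + ‖x‖ ^ p)) := by
        gcongr
        exact_mod_cast NNReal.rpow_add_le_mul_rpow_add_rpow 1 ‖x‖₊ hp1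
    _ = _ := by rw [Real.one_rpow]; ring

/-- `∇V` and `gradientOuter V` are locally Lipschitz with a constant of order `(1 + V)^{1/q}`. The
growth assumption bounds the Hessian on the segment by `(1 + V) / (1 + ‖·‖)²` at the endpoint of
larger norm, and `(1 + V)^{1 - 1/q} ≲ 1 + ‖·‖`. -/
theorem exists_lipschitz_gradient (hV : GrowthAssumption V) {q : ℝ} (hVq : IndexAssumption V q) :
    ∃ C : ℝ, 0 < C ∧ ∀ x y,
      ‖gradient V x - gradient V y‖
        ≤ C * (((1 + V x) ^ (1 / q) + (1 + V y) ^ (1 / q)) * ‖x - y‖) ∧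
      ‖gradientOuter V x - gradientOuter V y‖
        ≤ C * (((1 + V x) ^ (1 / q) + (1 + V y) ^ (1 / q)) * ‖x - y‖) := by
  obtain ⟨C₁, hC₁, h₁⟩ := hV.growth 1 1 one_pos one_pos
  obtain ⟨C₂, hC₂, h₂⟩ := exists_rpow_le hV hVq
  have hw : ∀ x, 0 < 1 + V x := fun x => by linarith [hV.nonneg x]
  -- one power of `1 + ‖u‖` in the growth assumption is traded for `(1 + V u)^{1 - 1/q}`
  have key : ∀ u z, ‖z‖ ≤ ‖u‖ → ‖gradient V z‖ + (1 + ‖u‖) * ‖hessian V z‖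
      ≤ C₁ * C₂ * (1 + V u) ^ (1 / q) := by
    intro u z hz
    have h3 := h₁ u z (by linarith)
    have h4 : 1 + V u = (1 + V u) ^ (1 - 1 / q) * (1 + V u) ^ (1 / q) := by
      rw [← Real.rpow_add (hw u)]; simp
    have h5 := h₂ u
    have h6 := Real.rpow_pos_of_pos (hw u) (1 / q)
    have h7 : 0 < 1 + ‖u‖ := by positivity
    refine le_of_mul_le_mul_left ?_ h7
    calc (1 + ‖u‖) * (‖gradient V z‖ + (1 + ‖u‖) * ‖hessian V z‖)
        = (1 + ‖u‖) * ‖gradient V z‖ + (1 + ‖u‖) ^ 2 * ‖hessian V z‖ := by ring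
      _ ≤ C₁ * (1 + V u) := h3
      _ = C₁ * ((1 + V u) ^ (1 - 1 / q) * (1 + V u) ^ (1 / q)) := by rw [← h4]
      _ ≤ C₁ * (C₂ * (1 + ‖u‖) * (1 + V u) ^ (1 / q)) := by gcongr
      _ = _ := by ring
  have hD := (contDiff_gradient hV.smooth).differentiable (by simp)
  have main : ∀ x y u : Space d, ‖x‖ ≤ ‖u‖ → ‖y‖ ≤ ‖u‖ →
      (1 + ‖u‖) * ‖gradient V x - gradient V y‖ ≤ C₁ * C₂ * (1 + V u) ^ (1 / q) * ‖x - y‖ := by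
    intro x y u hx hy
    have h8 : ∀ z ∈ Metric.closedBall (0 : Space d) ‖u‖,
        ‖hessian V z‖ ≤ C₁ * C₂ * (1 + V u) ^ (1 / q) / (1 + ‖u‖) := by
      intro z hz
      rw [le_div_iff₀ (by positivity), mul_comm]
      linarith [key u z (by simpa using hz), norm_nonneg (gradient V z)]
    have h9 := (convex_closedBall (0 : Space d) ‖u‖).norm_image_sub_le_of_norm_hasFDerivWithin_le
      (fun z _ => (hD z).hasFDerivAt.hasFDerivWithinAt) h8 (by simpa using hy) (by simpa using hx)
    rw [div_mul_eq_mul_div, le_div_iff₀ (by positivity), mul_comm] at h9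
    exact h9
  have both : ∀ x y u : Space d, ‖x‖ ≤ ‖u‖ → ‖y‖ ≤ ‖u‖ →
      ‖gradient V x - gradient V y‖ ≤ 2 * (C₁ * C₂) * ((1 + V u) ^ (1 / q) * ‖x - y‖) ∧
      ‖gradientOuter V x - gradientOuter V y‖
        ≤ 2 * (C₁ * C₂) * ((1 + V u) ^ (1 / q) * ‖x - y‖) := by
    intro x y u hx hy
    have h10 := main x y u hx hy
    have h11 := key u x hx
    have h12 : 0 ≤ (1 + ‖u‖) * ‖hessian V x‖ := by positivity
    have h13 : 0 ≤ ‖u‖ * ‖gradient V x - gradient V y‖ := by positivity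
    have h14 : 0 ≤ C₁ * C₂ * (1 + V u) ^ (1 / q) * ‖x - y‖ := by
      have := Real.rpow_nonneg (hw u).le (1 / q)
      positivity
    refine ⟨by linarith, (norm_gradientOuter_sub_le x y).trans ?_⟩
    have h15 : ‖y‖ * ‖gradient V x - gradient V y‖ ≤ ‖u‖ * ‖gradient V x - gradient V y‖ := by
      gcongr
    have h16 : ‖x - y‖ * ‖gradient V x‖ ≤ ‖x - y‖ * (C₁ * C₂ * (1 + V u) ^ (1 / q)) := by
      gcongr; linarith
    linarith [norm_nonneg (gradient V x - gradient V y)]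
  refine ⟨2 * (C₁ * C₂), by positivity, fun x y => ?_⟩
  have hx := Real.rpow_nonneg (hw x).le (1 / q)
  have hy := Real.rpow_nonneg (hw y).le (1 / q)
  rcases le_total ‖x‖ ‖y‖ with h | h
  · obtain ⟨ha, hb⟩ := both x y y h le_rfl
    have : 2 * (C₁ * C₂) * ((1 + V y) ^ (1 / q) * ‖x - y‖)
        ≤ 2 * (C₁ * C₂) * (((1 + V x) ^ (1 / q) + (1 + V y) ^ (1 / q)) * ‖x - y‖) := by
      gcongr; linarith
    exact ⟨ha.trans this, hb.trans this⟩
  · obtain ⟨ha, hb⟩ := both x y x le_rfl h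
    have : 2 * (C₁ * C₂) * ((1 + V x) ^ (1 / q) * ‖x - y‖)
        ≤ 2 * (C₁ * C₂) * (((1 + V x) ^ (1 / q) + (1 + V y) ^ (1 / q)) * ‖x - y‖) := by
      gcongr; linarith
    exact ⟨ha.trans this, hb.trans this⟩

end

/-! ### From the weak formulation in time to the integrated equation -/

/-- If `F' = G` on `[0, ∞)` holds against test functions in time, then `F` is a primitive of `G`.
The test functions used are smooth steps that drop from `1` to `0` on `[t, t + ε]`. -/
theorem sub_eq_integral_of_weak {F G : ℝ → ℝ} (hF : ContinuousOn F (Ici 0))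
    (hGm : AEStronglyMeasurable G (volume.restrict (Ioi 0)))
    (hGb : ∀ T, 0 < T → ∃ B, ∀ t ∈ Ioc 0 T, ‖G t‖ ≤ B)
    (hweak : ∀ η : ℝ → ℝ, ContDiff ℝ ∞ η → HasCompactSupport η →
      (∫ t in Ioi (0 : ℝ), (deriv η t * F t + η t * G t)) + η 0 * F 0 = 0)
    {t : ℝ} (ht : 0 ≤ t) : F t - F 0 = ∫ s in (0 : ℝ)..t, G s := by
  rcases ht.eq_or_lt with rfl | ht
  · simp
  let ε : ℕ → ℝ := fun n => 1 / ((n : ℝ) + 1)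
  have hε : ∀ n, 0 < ε n := fun n => by simp only [ε]; positivity
  have hε1 : ∀ n, ε n ≤ 1 := fun n => by
    simp only [ε]; rw [div_le_one (by positivity)]; linarith [(n.cast_nonneg : (0 : ℝ) ≤ n)]
  have hεlim : Tendsto ε atTop (𝓝 0) := tendsto_one_div_add_atTop_nhds_zero_nat
  -- the second factor of `η` is `1` on `[-1, ∞)` and only serves to make the support compact
  let κ : ℕ → ℝ → ℝ := fun n s => Real.smoothTransition ((t + ε n - s) / ε n)
  let η : ℕ → ℝ → ℝ := fun n s => κ n s * Real.smoothTransition (s + 2)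
  have hκs : ∀ n, ContDiff ℝ ∞ (κ n) := fun n =>
    Real.smoothTransition.contDiff.comp (by fun_prop)
  have hηs : ∀ n, ContDiff ℝ ∞ (η n) := fun n =>
    (hκs n).mul (Real.smoothTransition.contDiff.comp (by fun_prop))
  have hκ1 : ∀ n s, s ≤ t → κ n s = 1 := fun n s hs => by
    refine Real.smoothTransition.one_of_one_le ?_
    rw [one_le_div (hε n)]; linarith
  have hκ0 : ∀ n s, t + ε n ≤ s → κ n s = 0 := fun n s hs => by
    refine Real.smoothTransition.zero_of_nonpos (div_nonpos_of_nonpos_of_nonneg (by linarith)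
      (hε n).le)
  have hκa : ∀ n, Antitone (κ n) := fun n a b hab => by
    refine Real.smoothTransition.monotone ?_
    have := hε n
    gcongr
  have hηκ : ∀ n s, -1 ≤ s → η n s = κ n s := fun n s hs => by
    simp only [η]
    rw [Real.smoothTransition.one_of_one_le (by linarith), mul_one]
  have hηc : ∀ n, HasCompactSupport (η n) := fun n => by
    refine HasCompactSupport.of_support_subset_isCompact (isCompact_Icc (a := -2) (b := t + ε n)) ?_
    intro s hs
    rw [Function.mem_support] at hs
    refine ⟨?_, ?_⟩
    · by_contra h
      exact hs (by simp only [η]; rw [Real.smoothTransition.zero_of_nonpos (x := s + 2)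
        (by linarith), mul_zero])
    · by_contra h
      exact hs (by simp only [η]; rw [hκ0 n s (by linarith), zero_mul])
  have hdη : ∀ n s, 0 < s → deriv (η n) s = deriv (κ n) s := fun n s hs => by
    refine Filter.EventuallyEq.deriv_eq ?_
    filter_upwards [lt_mem_nhds (show (-1 : ℝ) < s by linarith)] with r hr using hηκ n r hr.le
  have hdκ0 : ∀ n s, s ∉ Icc t (t + ε n) → deriv (κ n) s = 0 := fun n s hs => by
    rw [mem_Icc, not_and_or, not_le, not_le] at hs
    rcases hs with hs | hs
    · have : κ n =ᶠ[𝓝 s] fun _ => 1 := by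
        filter_upwards [gt_mem_nhds hs] with r hr using hκ1 n r hr.le
      rw [this.deriv_eq]; simp
    · have : κ n =ᶠ[𝓝 s] fun _ => 0 := by
        filter_upwards [lt_mem_nhds hs] with r hr using hκ0 n r hr.le
      rw [this.deriv_eq]; simp
  have hdκc : ∀ n, Continuous (deriv (κ n)) := fun n => (hκs n).continuous_deriv (by simp)
  have hte : ∀ n, t ≤ t + ε n := fun n => by linarith [hε n]
  have hsub : ∀ n, Icc t (t + ε n) ⊆ Ici 0 := fun n s hs => ht.le.trans hs.1
  have hIFκ : ∀ n, IntegrableOn (fun s => deriv (κ n) s * F s) (Icc t (t + ε n)) := fun n =>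
    ((hdκc n).continuousOn.mul (hF.mono (hsub n))).integrableOn_Icc
  have hIF : ∀ n, IntegrableOn (fun s => deriv (η n) s * F s) (Ioi 0) := fun n => by
    have h1 : IntegrableOn (fun s => deriv (κ n) s * F s) (Ioi 0) :=
      (hIFκ n).of_forall_sdiff_eq_zero measurableSet_Ioi fun s hs => by
        rw [hdκ0 n s hs.2, zero_mul]
    exact h1.congr_fun (fun s hs => by rw [hdη n s hs]) measurableSet_Ioi
  have hFeq : ∀ n, ∫ s in Ioi (0 : ℝ), deriv (η n) s * F s
      = ∫ s in t..t + ε n, deriv (κ n) s * F s := fun n => by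
    rw [intervalIntegral.integral_of_le (hte n), ← integral_Icc_eq_integral_Ioc,
      setIntegral_congr_fun (g := fun s => deriv (κ n) s * F s) measurableSet_Ioi
        (fun s hs => by simp only [hdη n s hs])]
    exact setIntegral_eq_of_subset_of_forall_sdiff_eq_zero measurableSet_Ioi
      (fun s hs => ht.trans_le hs.1) (fun s hs => by rw [hdκ0 n s hs.2, zero_mul])
  have hdκI : ∀ n, ∫ s in t..t + ε n, deriv (κ n) s = -1 := fun n => by
    rw [intervalIntegral.integral_deriv_eq_sub
      (fun s _ => (hκs n).differentiable (by simp) s) ((hdκc n).intervalIntegrable _ _),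
      hκ1 n t le_rfl, hκ0 n _ le_rfl]
    norm_num
  have hlimF : Tendsto (fun n => ∫ s in Ioi (0 : ℝ), deriv (η n) s * F s) atTop (𝓝 (-F t)) := by
    rw [Metric.tendsto_atTop]
    intro δ hδ
    have hFt : ContinuousWithinAt F (Ici 0) t := hF t ht.le
    obtain ⟨r, hr, hFr⟩ := Metric.continuousWithinAt_iff.1 hFt (δ / 2) (by positivity)
    obtain ⟨N, hN⟩ := Metric.tendsto_atTop.1 hεlim r hr
    refine ⟨N, fun n hn => ?_⟩
    have hεr : ε n < r := by
      have := hN n hn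
      rwa [Real.dist_eq, sub_zero, abs_of_pos (hε n)] at this
    have h2 : (∫ s in t..t + ε n, deriv (κ n) s * F s) - -F t
        = ∫ s in t..t + ε n, deriv (κ n) s * (F s - F t) := by
      have hi : IntervalIntegrable (fun s => deriv (κ n) s * F s) volume t (t + ε n) :=
        (intervalIntegrable_iff_integrableOn_Icc_of_le (hte n)).2 (hIFκ n)
      simp only [mul_sub]
      rw [intervalIntegral.integral_sub hi (((hdκc n).intervalIntegrable _ _).mul_const _),
        intervalIntegral.integral_mul_const, hdκI]
      ring
    have h3 : ‖∫ s in t..t + ε n, deriv (κ n) s * (F s - F t)‖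
        ≤ ∫ s in t..t + ε n, -deriv (κ n) s * (δ / 2) := by
      refine intervalIntegral.norm_integral_le_of_norm_le (hte n)
        (Eventually.of_forall fun s hs => ?_)
        (((hdκc n).neg.intervalIntegrable _ _).mul_const _)
      rw [norm_mul, Real.norm_eq_abs, abs_of_nonpos ((hκa n).deriv_nonpos)]
      have h4 : dist (F s) (F t) < δ / 2 := by
        refine hFr (show s ∈ Ici 0 from ht.le.trans hs.1.le) ?_
        rw [Real.dist_eq, abs_of_pos (sub_pos.2 hs.1)]
        linarith [hs.2]
      rw [← dist_eq_norm]
      exact mul_le_mul_of_nonneg_left h4.le (neg_nonneg.2 (hκa n).deriv_nonpos)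
    rw [intervalIntegral.integral_mul_const, intervalIntegral.integral_neg, hdκI] at h3
    rw [hFeq, dist_eq_norm, h2]
    linarith
  have hIGT : ∀ T, 0 < T → IntegrableOn G (Ioc 0 T) := fun T hT => by
    obtain ⟨B, hB⟩ := hGb T hT
    exact Integrable.of_bound (hGm.mono_set Ioc_subset_Ioi_self) B
      ((ae_restrict_iff' measurableSet_Ioc).2 (Eventually.of_forall hB))
  have hηG : ∀ n s, s ∈ Ioi (0 : ℝ) → ‖η n s * G s‖ ≤ (Ioc 0 (t + 1)).indicator (fun s => ‖G s‖) s
      := by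
    intro n s hs
    have hs' : (0 : ℝ) < s := hs
    rw [hηκ n s (by linarith), norm_mul]
    by_cases h : s ∈ Ioc 0 (t + 1)
    · rw [indicator_of_mem h]
      refine mul_le_of_le_one_left (norm_nonneg _) ?_
      rw [Real.norm_eq_abs, abs_of_nonneg (Real.smoothTransition.nonneg _)]
      exact Real.smoothTransition.le_one _
    · rw [indicator_of_notMem h, hκ0 n s, norm_zero, zero_mul]
      by_contra h'
      exact h ⟨hs, by linarith [hε1 n]⟩
  have hbd : IntegrableOn ((Ioc 0 (t + 1)).indicator (fun s => ‖G s‖)) (Ioi 0) :=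
    ((integrable_indicator_iff measurableSet_Ioc).2
      (hIGT (t + 1) (by linarith)).norm).integrableOn
  have hηGm : ∀ n, AEStronglyMeasurable (fun s => η n s * G s) (volume.restrict (Ioi 0)) := fun n =>
    ((hηs n).continuous.aestronglyMeasurable).mul hGm
  have hIG : ∀ n, IntegrableOn (fun s => η n s * G s) (Ioi 0) := fun n =>
    Integrable.mono' hbd (hηGm n)
      ((ae_restrict_iff' measurableSet_Ioi).2 (Eventually.of_forall (hηG n)))
  have hlimG : Tendsto (fun n => ∫ s in Ioi (0 : ℝ), η n s * G s) atTop
      (𝓝 (∫ s in Ioi (0 : ℝ), (Ioc 0 t).indicator G s)) := by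
    refine tendsto_integral_of_dominated_convergence _ hηGm hbd
      (fun n => (ae_restrict_iff' measurableSet_Ioi).2 (Eventually.of_forall (hηG n)))
      ((ae_restrict_iff' measurableSet_Ioi).2 (Eventually.of_forall fun s hs => ?_))
    have hs' : (0 : ℝ) < s := hs
    refine tendsto_const_nhds.congr' ?_
    rcases le_or_gt s t with hst | hst
    · refine Eventually.of_forall fun n => ?_
      simp only
      rw [indicator_of_mem (show s ∈ Ioc 0 t from ⟨hs, hst⟩), hηκ n s (by linarith), hκ1 n s hst,
        one_mul]
    · filter_upwards [hεlim.eventually (gt_mem_nhds (sub_pos.2 hst))] with n hn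
      rw [indicator_of_notMem (fun h => absurd h.2 (not_le.2 hst)), hηκ n s (by linarith),
        hκ0 n s (by linarith), zero_mul]
  rw [setIntegral_indicator measurableSet_Ioc, inter_eq_self_of_subset_right Ioc_subset_Ioi_self,
    ← intervalIntegral.integral_of_le ht.le] at hlimG
  have hlim := (hlimF.add hlimG).add_const (F 0)
  have hzero : ∀ n, (∫ s in Ioi (0 : ℝ), deriv (η n) s * F s) + (∫ s in Ioi (0 : ℝ), η n s * G s)
      + F 0 = 0 := fun n => by
    have := hweak (η n) (hηs n) (hηc n)
    rwa [integral_add (hIF n) (hIG n), hηκ n 0 (by norm_num), hκ1 n 0 ht.le, one_mul] at this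
  simp only [hzero] at hlim
  have := tendsto_nhds_unique hlim tendsto_const_nhds
  linarith

/-! ### The velocity is affine in space -/

section
variable {d : ℕ} {V : Space d → ℝ} {ρ : Measure (Space d)}

theorem integrable_of_norm_le {E : Type*} [NormedAddCommGroup E]
    (hw : Integrable (fun x => 1 + V x) ρ) {f : Space d → E} (hf : Continuous f) {C : ℝ}
    (hle : ∀ x, ‖f x‖ ≤ C * (1 + V x)) : Integrable f ρ :=
  (hw.const_mul C).mono' hf.aestronglyMeasurable (Eventually.of_forall hle)

theorem norm_integral_le_mul {E : Type*} [NormedAddCommGroup E] [NormedSpace ℝ E]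
    (hw : Integrable (fun x => 1 + V x) ρ) {f : Space d → E} {C : ℝ}
    (hle : ∀ x, ‖f x‖ ≤ C * (1 + V x)) : ‖∫ x, f x ∂ρ‖ ≤ C * ∫ x, (1 + V x) ∂ρ := by
  rw [← integral_const_mul]
  exact norm_integral_le_of_norm_le (hw.const_mul C) (Eventually.of_forall hle)

/-- The linear part `I - ∫ ∇V(y) yᵀ dρ(y)` of the velocity field. -/
noncomputable def velocityLinear (V : Space d → ℝ) (ρ : Measure (Space d)) :
    Space d →L[ℝ] Space d :=
  ContinuousLinearMap.id ℝ (Space d) - ∫ y, gradientOuter V y ∂ρ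

/-- The constant part `-∫ ∇V dρ` of the velocity field. -/
noncomputable def velocityConst (V : Space d → ℝ) (ρ : Measure (Space d)) : Space d :=
  -∫ y, gradient V y ∂ρ

theorem GrowthAssumption.exists_gradient_bounds (hV : GrowthAssumption V) :
    ∃ C : ℝ, 0 < C ∧ ∀ x, (1 + ‖x‖) * ‖gradient V x‖ ≤ C * (1 + V x) ∧
      ‖gradient V x‖ ≤ C * (1 + V x) ∧ ‖gradientOuter V x‖ ≤ C * (1 + V x) := by
  obtain ⟨C, hC, h⟩ := hV.exists_gradient_le
  refine ⟨C, hC, fun x => ⟨h x, ?_, ?_⟩⟩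
  · nlinarith [h x, norm_nonneg x, norm_nonneg (gradient V x)]
  · rw [norm_gradientOuter]
    nlinarith [h x, norm_nonneg x, norm_nonneg (gradient V x)]

theorem integrable_gradient (hV : GrowthAssumption V) (hw : Integrable (fun x => 1 + V x) ρ) :
    Integrable (gradient V) ρ := by
  obtain ⟨C, -, h⟩ := hV.exists_gradient_bounds
  exact integrable_of_norm_le hw (contDiff_gradient hV.smooth).continuous fun x => (h x).2.1

theorem integrable_gradientOuter (hV : GrowthAssumption V)
    (hw : Integrable (fun x => 1 + V x) ρ) : Integrable (gradientOuter V) ρ := by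
  obtain ⟨C, -, h⟩ := hV.exists_gradient_bounds
  exact integrable_of_norm_le hw (continuous_gradientOuter hV.smooth) fun x => (h x).2.2

theorem velocity_eq [IsProbabilityMeasure ρ] (hV : GrowthAssumption V)
    (hw : Integrable (fun x => 1 + V x) ρ) (x : Space d) :
    velocity V ρ x = velocityLinear V ρ x + velocityConst V ρ := by
  have h1 : ∀ y, gradient (fun z => bilinearKernel x z) y = x := fun y => by
    refine HasGradientAt.gradient (hasGradientAt_iff_hasFDerivAt.2 ?_)
    exact (InnerProductSpace.toDual ℝ (Space d) x).hasFDerivAt.add_const 1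
  have h2 : ∀ y, bilinearKernel x y • gradient V y = gradientOuter V y x + gradient V y :=
    fun y => by
      rw [bilinearKernel, gradientOuter_apply, add_smul, one_smul, real_inner_comm]
  have hO := integrable_gradientOuter hV hw
  rw [velocity]
  simp only [h1, h2]
  rw [integral_const, probReal_univ, one_smul,
    integral_add (hO.apply_continuousLinearMap x) (integrable_gradient hV hw),
    ← ContinuousLinearMap.integral_apply hO, velocityLinear, velocityConst]
  simp only [sub_apply, ContinuousLinearMap.id_apply]
  abel

theorem velocity_coord [IsProbabilityMeasure ρ] (hV : GrowthAssumption V)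
    (hw : Integrable (fun x => 1 + V x) ρ) (x : Space d) (j : Fin d) :
    velocity V ρ x j = x j - ∑ i, x i * ∫ y, y i * gradient V y j ∂ρ - ∫ y, gradient V y j ∂ρ := by
  have hO := integrable_gradientOuter hV hw
  have hg := integrable_gradient hV hw
  have hproj : ∀ {f : Space d → Space d}, Integrable f ρ → (∫ y, f y ∂ρ) j = ∫ y, f y j ∂ρ :=
    fun {f} hf => ((EuclideanSpace.proj (𝕜 := ℝ) j).integral_comp_comm hf).symm
  have hi : ∀ i, Integrable (fun y => y i * gradient V y j) ρ := fun i => by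
    have := (EuclideanSpace.proj (𝕜 := ℝ) j).integrable_comp
      (hO.apply_continuousLinearMap (EuclideanSpace.single i 1))
    simpa [gradientOuter_apply, EuclideanSpace.inner_single_right] using this
  rw [velocity_eq hV hw, velocityLinear, velocityConst]
  simp only [sub_apply, ContinuousLinearMap.id_apply, PiLp.add_apply,
    PiLp.sub_apply, PiLp.neg_apply]
  rw [hproj hg, ContinuousLinearMap.integral_apply hO, hproj (hO.apply_continuousLinearMap x),
    ← sub_eq_add_neg]
  congr 2
  simp only [← integral_const_mul]
  rw [← integral_finsetSum _ fun i _ => (hi i).const_mul _]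
  refine integral_congr_ae (Eventually.of_forall fun y => ?_)
  simp only [gradientOuter_apply, PiLp.smul_apply, PiLp.inner_apply, smul_eq_mul, Finset.sum_mul]
  refine Finset.sum_congr rfl fun i _ => ?_
  simp
  ring

/-- The functions whose means make up the rate of change of `∫ f dμ_t`, for `g = ∇f`. -/
theorem abs_coord_mul_le {g : Space d → Space d} {C : ℝ}
    (hg : ∀ x, (1 + ‖x‖) * ‖g x‖ ≤ C * (1 + V x)) (i j : Fin d) (x : Space d) :
    ‖x i * g x j‖ ≤ C * (1 + V x) ∧ ‖g x j‖ ≤ C * (1 + V x) ∧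
      ‖(inner ℝ (g x) x : ℝ)‖ ≤ C * (1 + V x) := by
  have h := hg x
  have hx := PiLp.norm_apply_le x i
  have hgx := PiLp.norm_apply_le (g x) j
  have h1 := norm_nonneg x
  have h2 := norm_nonneg (g x)
  refine ⟨?_, by nlinarith, (norm_inner_le_norm _ _).trans (by nlinarith)⟩
  rw [norm_mul]
  have : ‖x i‖ * ‖g x j‖ ≤ ‖x‖ * ‖g x‖ := by gcongr
  nlinarith

/-- The power of a force field `g` along the velocity. For `g = ∇V` the two sums are sums of
squares: this is the positivity of the kernel. -/
theorem integral_inner_velocity [IsProbabilityMeasure ρ] (hV : GrowthAssumption V)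
    (hw : Integrable (fun x => 1 + V x) ρ) {g : Space d → Space d} (hgc : Continuous g) {C : ℝ}
    (hg : ∀ x, (1 + ‖x‖) * ‖g x‖ ≤ C * (1 + V x)) :
    ∫ x, inner ℝ (g x) (velocity V ρ x) ∂ρ
      = ∫ x, (inner ℝ (g x) x : ℝ) ∂ρ
        - ∑ j, ∑ i, (∫ x, x i * g x j ∂ρ) * ∫ x, x i * gradient V x j ∂ρ
        - ∑ j, (∫ x, g x j ∂ρ) * ∫ x, gradient V x j ∂ρ := by
  have hgj : ∀ j : Fin d, Continuous fun x => g x j := fun j => by fun_prop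
  have hI0 : ∀ j, Integrable (fun x => g x j) ρ := fun j =>
    integrable_of_norm_le hw (hgj j) fun x => (abs_coord_mul_le hg j j x).2.1
  have hI1 : ∀ i j, Integrable (fun x => x i * g x j) ρ := fun i j =>
    integrable_of_norm_le hw (by fun_prop) fun x => (abs_coord_mul_le hg i j x).1
  have hI2 : Integrable (fun x => (inner ℝ (g x) x : ℝ)) ρ :=
    integrable_of_norm_le hw (C := C) (by fun_prop) fun x => by
      refine (norm_inner_le_norm _ _).trans ?_
      nlinarith [hg x, norm_nonneg x, norm_nonneg (g x)]
  have hpt : ∀ x, (inner ℝ (g x) (velocity V ρ x) : ℝ) = inner ℝ (g x) x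
      - ∑ j, ∑ i, (x i * g x j) * (∫ y, y i * gradient V y j ∂ρ)
      - ∑ j, g x j * ∫ y, gradient V y j ∂ρ := by
    intro x
    simp only [PiLp.inner_apply, velocity_coord hV hw, RCLike.inner_apply, conj_trivial]
    rw [← Finset.sum_sub_distrib, ← Finset.sum_sub_distrib]
    refine Finset.sum_congr rfl fun j _ => ?_
    rw [sub_mul, sub_mul, Finset.sum_mul]
    congr 1
    · congr 1
      exact Finset.sum_congr rfl fun i _ => by ring
    · ring
  simp only [hpt]
  rw [integral_sub, integral_sub hI2, integral_finsetSum, integral_finsetSum]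
  · congr 1
    · congr 1
      refine Finset.sum_congr rfl fun j _ => ?_
      rw [integral_finsetSum _ fun i _ => (hI1 i j).mul_const _]
      exact Finset.sum_congr rfl fun i _ => integral_mul_const _ _
    · exact Finset.sum_congr rfl fun j _ => integral_mul_const _ _
  · exact fun j _ => (hI0 j).mul_const _
  · exact fun j _ => integrable_finsetSum _ fun i _ => (hI1 i j).mul_const _
  · exact integrable_finsetSum _ fun j _ => integrable_finsetSum _ fun i _ =>
      (hI1 i j).mul_const _
  · exact hI2.sub (integrable_finsetSum _ fun j _ => integrable_finsetSum _ fun i _ =>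
      (hI1 i j).mul_const _)
  · exact integrable_finsetSum _ fun j _ => (hI0 j).mul_const _

theorem norm_velocityLinear_le (hw : Integrable (fun x => 1 + V x) ρ) {C : ℝ}
    (hC : ∀ x, ‖gradientOuter V x‖ ≤ C * (1 + V x)) :
    ‖velocityLinear V ρ‖ ≤ 1 + C * ∫ x, (1 + V x) ∂ρ :=
  (norm_sub_le _ _).trans
    (add_le_add ContinuousLinearMap.norm_id_le (norm_integral_le_mul hw hC))

theorem norm_velocityConst_le (hw : Integrable (fun x => 1 + V x) ρ) {C : ℝ}
    (hC : ∀ x, ‖gradient V x‖ ≤ C * (1 + V x)) :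
    ‖velocityConst V ρ‖ ≤ C * ∫ x, (1 + V x) ∂ρ := by
  rw [velocityConst, norm_neg]
  exact norm_integral_le_mul hw hC

end

/-! ### Test functions of the growth of the potential -/

section
variable {d : ℕ} {V : Space d → ℝ}

theorem norm_velocity_le {ρ : Measure (Space d)} [IsProbabilityMeasure ρ]
    (hV : GrowthAssumption V) (hw : Integrable (fun x => 1 + V x) ρ) {C : ℝ}
    (h1 : ∀ x, ‖gradient V x‖ ≤ C * (1 + V x)) (h2 : ∀ x, ‖gradientOuter V x‖ ≤ C * (1 + V x))
    (x : Space d) : ‖velocity V ρ x‖ ≤ (1 + C * ∫ x, (1 + V x) ∂ρ) * (1 + ‖x‖) := by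
  rw [velocity_eq hV hw]
  have h3 := norm_velocityLinear_le hw h2
  have h4 := norm_velocityConst_le hw h1
  calc _ ≤ ‖velocityLinear V ρ‖ * ‖x‖ + ‖velocityConst V ρ‖ :=
        (norm_add_le _ _).trans (add_le_add_left (ContinuousLinearMap.le_opNorm _ _) _)
    _ ≤ (1 + C * ∫ x, (1 + V x) ∂ρ) * ‖x‖ + C * ∫ x, (1 + V x) ∂ρ := by gcongr
    _ ≤ _ := by linarith

/-- A smooth function that grows at most like `1 + V`, and whose derivative along any affine
vector field does so as well. -/
structure Admissible (V f : Space d → ℝ) (C : ℝ) : Prop where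
  smooth : ContDiff ℝ ∞ f
  bound : ∀ x, ‖f x‖ ≤ C * (1 + V x)
  grad : ∀ x, (1 + ‖x‖) * ‖gradient f x‖ ≤ C * (1 + V x)

theorem GrowthAssumption.exists_admissible (hV : GrowthAssumption V) :
    ∃ C : ℝ, 0 < C ∧ Admissible V V C := by
  obtain ⟨C, hC, h⟩ := hV.exists_gradient_le
  refine ⟨C + 1, by linarith, hV.smooth, fun x => ?_, fun x => (h x).trans ?_⟩
  · rw [Real.norm_eq_abs, abs_of_nonneg (hV.nonneg x)]
    nlinarith [hV.nonneg x]
  · nlinarith [hV.nonneg x]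

theorem Admissible.continuous_gradient {f : Space d → ℝ} {C : ℝ} (hf : Admissible V f C) :
    Continuous (gradient f) := (contDiff_gradient hf.smooth).continuous

theorem hasCompactSupport_gradient {f : Space d → ℝ} (hf : HasCompactSupport f) :
    HasCompactSupport (gradient f) := by
  refine (hf.fderiv (𝕜 := ℝ)).mono fun x hx => ?_
  rw [Function.mem_support] at hx ⊢
  rwa [← norm_ne_zero_iff, ← norm_gradient, norm_ne_zero_iff]

theorem exists_admissible_of_hasCompactSupport (hV : GrowthAssumption V) {f : Space d → ℝ}
    (hf : ContDiff ℝ ∞ f) (hfc : HasCompactSupport f) : ∃ C, Admissible V f C := by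
  obtain ⟨C₁, h₁⟩ := hfc.exists_bound_of_continuous hf.continuous
  obtain ⟨C₂, h₂⟩ := HasCompactSupport.exists_bound_of_continuous
    (f := fun x => (1 + ‖x‖) • gradient f x)
    ((hasCompactSupport_gradient hfc).smul_left (f := fun x => 1 + ‖x‖))
    ((by fun_prop : Continuous fun x : Space d => 1 + ‖x‖).smul (contDiff_gradient hf).continuous)
  refine ⟨max C₁ C₂, hf, fun x => ?_, fun x => ?_⟩
  · have h3 := (norm_nonneg _).trans (h₁ x)
    have h4 := le_max_left C₁ C₂
    nlinarith [h₁ x, hV.nonneg x]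
  · have h3 := (norm_nonneg _).trans (h₂ x)
    have h4 := le_max_right C₁ C₂
    have h5 := h₂ x
    rw [norm_smul, Real.norm_eq_abs, abs_of_pos (by positivity)] at h5
    nlinarith [hV.nonneg x]

/-- Admissible functions are limits of compactly supported ones, with uniform constants: cut off at
scale `n + 1`. -/
theorem Admissible.exists_approx {f : Space d → ℝ} {C : ℝ}
    (hf : Admissible V f C) : ∃ (C' : ℝ) (F : ℕ → Space d → ℝ),
      (∀ n, Admissible V (F n) C') ∧ (∀ n, HasCompactSupport (F n)) ∧
      ∀ x, ∀ᶠ n in atTop, F n =ᶠ[𝓝 x] f := by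
  let χ : ContDiffBump (0 : Space d) := ⟨1, 2, one_pos, one_lt_two⟩
  have hχs : ContDiff ℝ ∞ χ := χ.contDiff
  obtain ⟨D, hD⟩ := (χ.hasCompactSupport.fderiv (𝕜 := ℝ)).exists_bound_of_continuous
    (hχs.continuous_fderiv (by simp))
  have hD0 : 0 ≤ D := (norm_nonneg _).trans (hD 0)
  let c : ℕ → ℝ := fun n => (n : ℝ) + 1
  have hc : ∀ n, 1 ≤ c n := fun n => by simp [c]
  let F : ℕ → Space d → ℝ := fun n x => χ ((c n)⁻¹ • x) * f x
  have hχns : ∀ n, ContDiff ℝ ∞ fun x : Space d => χ ((c n)⁻¹ • x) := fun n =>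
    hχs.comp (contDiff_const_smul _)
  have hC : ∀ x, 0 ≤ C * (1 + V x) := fun x => (norm_nonneg _).trans (hf.bound x)
  have hχ1 : ∀ y, ‖χ y‖ ≤ 1 := fun y => by
    rw [Real.norm_eq_abs, abs_of_nonneg χ.nonneg]; exact χ.le_one
  have hχfd : ∀ n x, HasFDerivAt (fun x : Space d => χ ((c n)⁻¹ • x))
      ((c n)⁻¹ • fderiv ℝ χ ((c n)⁻¹ • x)) x := fun n x => by
    have h1 := (hχs.differentiable (by simp) ((c n)⁻¹ • x)).hasFDerivAt
    have h2 := h1.comp x ((hasFDerivAt_id x).const_smul (c n)⁻¹)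
    exact h2.congr_fderiv (by ext v; simp)
  have hχb : ∀ n x, (1 + ‖x‖) * ‖(c n)⁻¹ • fderiv ℝ χ ((c n)⁻¹ • x)‖ ≤ 3 * D := by
    intro n x
    have hcn := hc n
    have hcn0 : 0 < c n := by linarith
    by_cases hx : ‖x‖ ≤ 2 * c n
    · rw [norm_smul, Real.norm_eq_abs, abs_of_pos (by positivity)]
      calc (1 + ‖x‖) * ((c n)⁻¹ * ‖fderiv ℝ χ ((c n)⁻¹ • x)‖)
          ≤ (3 * c n) * ((c n)⁻¹ * D) := by
            gcongr
            · linarith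
            · exact hD _
        _ = 3 * D := by field_simp
    · have h3 : (c n)⁻¹ • x ∉ tsupport (fderiv ℝ χ) := by
        intro h
        have h4 := tsupport_fderiv_subset ℝ h
        rw [χ.tsupport_eq, mem_closedBall_zero_iff, norm_smul, norm_inv, Real.norm_eq_abs,
          abs_of_pos hcn0, inv_mul_le_iff₀ hcn0] at h4
        exact hx (by linarith [show c n * χ.rOut = 2 * c n from mul_comm _ _])
      rw [image_eq_zero_of_notMem_tsupport h3, smul_zero, norm_zero, mul_zero]
      positivity
  refine ⟨C * (1 + 3 * D), F, fun n => ⟨(hχns n).mul hf.smooth, fun x => ?_, fun x => ?_⟩,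
    fun n => ?_, fun x => ?_⟩
  · rw [norm_mul]
    nlinarith [hf.bound x, hχ1 ((c n)⁻¹ • x), norm_nonneg (f x), hC x, mul_nonneg (hC x) hD0]
  · rw [norm_gradient]
    have h5 : HasFDerivAt (F n) _ x := (hχfd n x).mul (hf.smooth.differentiable (by simp) x).hasFDerivAt
    rw [h5.fderiv]
    have h6 := hf.grad x
    rw [norm_gradient] at h6
    have h7 := hχb n x
    have h8 := hf.bound x
    calc _ ≤ (1 + ‖x‖) * (‖χ ((c n)⁻¹ • x)‖ * ‖fderiv ℝ f x‖
          + ‖f x‖ * ‖(c n)⁻¹ • fderiv ℝ χ ((c n)⁻¹ • x)‖) := by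
          gcongr
          refine (norm_add_le _ _).trans (le_of_eq ?_)
          rw [norm_smul, norm_smul]
      _ = ‖χ ((c n)⁻¹ • x)‖ * ((1 + ‖x‖) * ‖fderiv ℝ f x‖)
          + ‖f x‖ * ((1 + ‖x‖) * ‖(c n)⁻¹ • fderiv ℝ χ ((c n)⁻¹ • x)‖) := by ring
      _ ≤ 1 * (C * (1 + V x)) + (C * (1 + V x)) * (3 * D) := by
          gcongr
          · exact hχ1 _
          · exact hC x
      _ = _ := by ring
  · have hcn0 : (c n)⁻¹ ≠ 0 := inv_ne_zero (by linarith [hc n])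
    exact (χ.hasCompactSupport.comp_homeomorph (Homeomorph.smulOfNeZero _ hcn0)).mul_right
  · obtain ⟨N, hN⟩ := exists_nat_gt ‖x‖
    filter_upwards [eventually_ge_atTop N] with n hn
    have h9 : ‖x‖ < c n := hN.trans_le (by
      have : (N : ℝ) ≤ n := by exact_mod_cast hn
      simp only [c]; linarith)
    filter_upwards [continuous_norm.continuousAt.eventually (gt_mem_nhds h9)] with y hy
    have hcn0 : 0 < c n := by linarith [hc n]
    have h10 : χ ((c n)⁻¹ • y) = 1 := χ.one_of_mem_closedBall (by
      rw [mem_closedBall_zero_iff, norm_smul, norm_inv, Real.norm_eq_abs, abs_of_pos hcn0,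
        inv_mul_le_iff₀ hcn0]
      simp only [χ]; linarith)
    simp only [F, h10, one_mul]

end

/-! ### Weak solutions tested against functions of the growth of the potential -/

section
variable {d : ℕ} {V : Space d → ℝ} {ν : Measure (Space d)}
  {μ : ℝ → ProbabilityMeasure (Space d)}

theorem integrable_of_potentialNorm_lt_top (hV : GrowthAssumption V) {ρ : Measure (Space d)}
    (h : potentialNorm V ρ < ⊤) : Integrable (fun x => 1 + V x) ρ := by
  have hc := hV.smooth.continuous
  refine ⟨by fun_prop, ?_⟩
  rw [hasFiniteIntegral_iff_ofReal (Eventually.of_forall fun x => by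
    simp only [Pi.zero_apply]; linarith [hV.nonneg x])]
  exact h

theorem IsWeakSolution.exists_integral_le (hV : GrowthAssumption V) (h : IsWeakSolution V ν μ)
    {T : ℝ} (hT : 0 < T) : ∃ B : ℝ, 0 ≤ B ∧ ∀ t ∈ Icc 0 T,
      Integrable (fun x => 1 + V x) (μ t : Measure (Space d)) ∧
      ∫ x, (1 + V x) ∂(μ t : Measure (Space d)) ≤ B := by
  have hb := h.bounded T hT
  refine ⟨(⨆ t ∈ Icc (0 : ℝ) T, potentialNorm V (μ t)).toReal, ENNReal.toReal_nonneg,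
    fun t ht => ?_⟩
  have hle : potentialNorm V (μ t) ≤ ⨆ t ∈ Icc (0 : ℝ) T, potentialNorm V (μ t) :=
    le_iSup₂_of_le t ht le_rfl
  have hi := integrable_of_potentialNorm_lt_top hV (hle.trans_lt hb)
  refine ⟨hi, ?_⟩
  rw [integral_eq_lintegral_of_nonneg_ae (Eventually.of_forall fun x => by
    simp only [Pi.zero_apply]; linarith [hV.nonneg x]) hi.aestronglyMeasurable]
  exact ENNReal.toReal_mono hb.ne hle

theorem IsWeakSolution.integrable (hV : GrowthAssumption V) (h : IsWeakSolution V ν μ) {t : ℝ}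
    (ht : 0 ≤ t) : Integrable (fun x => 1 + V x) (μ t : Measure (Space d)) := by
  obtain ⟨B, -, hB⟩ := h.exists_integral_le hV (show 0 < t + 1 by linarith)
  exact (hB t ⟨ht, by linarith⟩).1

theorem IsWeakSolution.continuousOn_integral_of_bounded (h : IsWeakSolution V ν μ)
    {f : Space d → ℝ} (hf : Continuous f) {C : ℝ} (hC : ∀ x, ‖f x‖ ≤ C) :
    ContinuousOn (fun t => ∫ x, f x ∂(μ t : Measure (Space d))) (Ici 0) := by
  intro t ht
  exact ProbabilityMeasure.tendsto_iff_forall_integral_tendsto.1 (h.continuousOn t ht)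
    (BoundedContinuousFunction.ofNormedAddCommGroup f hf C hC)

/-- Truncation of a real number to `[-n, n]`. -/
noncomputable def trunc (n : ℝ) (y : ℝ) : ℝ := max (-n) (min n y)

theorem continuous_trunc (n : ℝ) : Continuous (trunc n) := by unfold trunc; fun_prop

theorem abs_trunc_le {n : ℝ} (hn : 0 ≤ n) (y : ℝ) : |trunc n y| ≤ n :=
  abs_le.2 ⟨le_max_left _ _, max_le (by linarith) (min_le_left _ _)⟩

theorem abs_trunc_le_abs {n : ℝ} (hn : 0 ≤ n) (y : ℝ) : |trunc n y| ≤ |y| := by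
  unfold trunc; grind

/-- The truncation error at level `C n` of a quantity bounded by `C w`. -/
theorem abs_sub_trunc_le {C n y w : ℝ} (hC : 0 ≤ C) (hn : 0 ≤ n) (hy : |y| ≤ C * w) :
    |y - trunc (C * n) y| ≤ C * (w - min w n) := by
  have hCn : 0 ≤ C * n := mul_nonneg hC hn
  have h0 : 0 ≤ C * (w - min w n) := mul_nonneg hC (sub_nonneg.2 (min_le_left _ _))
  have h1 : C * w - C * n ≤ C * (w - min w n) := by
    rw [mul_sub]; gcongr; exact min_le_right _ _
  unfold trunc
  grind

theorem trunc_eq_self {n y : ℝ} (hy : |y| ≤ n) : trunc n y = y := by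
  unfold trunc; grind

theorem IsWeakSolution.aestronglyMeasurable_integral (hV : GrowthAssumption V)
    (h : IsWeakSolution V ν μ) {f : Space d → ℝ} (hf : Continuous f) {C : ℝ}
    (hC : ∀ x, ‖f x‖ ≤ C * (1 + V x)) :
    AEStronglyMeasurable (fun t => ∫ x, f x ∂(μ t : Measure (Space d)))
      (volume.restrict (Ioi 0)) := by
  refine aestronglyMeasurable_of_tendsto_ae atTop
    (f := fun (n : ℕ) t => ∫ x, trunc n (f x) ∂(μ t : Measure (Space d))) (fun n => ?_) ?_
  · exact ((h.continuousOn_integral_of_bounded ((continuous_trunc n).comp hf)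
      (fun x => abs_trunc_le n.cast_nonneg _)).mono Ioi_subset_Ici_self).aestronglyMeasurable
      measurableSet_Ioi
  · refine (ae_restrict_iff' measurableSet_Ioi).2 (Eventually.of_forall fun t ht => ?_)
    refine tendsto_integral_of_dominated_convergence (fun x => ‖f x‖)
      (fun n => ((continuous_trunc n).comp hf).aestronglyMeasurable)
      (integrable_of_norm_le (h.integrable hV (le_of_lt ht)) hf hC).norm
      (fun n => Eventually.of_forall fun x => abs_trunc_le_abs n.cast_nonneg _)
      (Eventually.of_forall fun x => ?_)
    refine tendsto_const_nhds.congr' ?_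
    obtain ⟨N, hN⟩ := exists_nat_ge |f x|
    filter_upwards [eventually_ge_atTop N] with n hn
    exact (trunc_eq_self (hN.trans (by exact_mod_cast hn))).symm

/-- The power of the force field `∇f` along the velocity, `d/dt ∫ f dμ_t` along a solution. -/
noncomputable def rate (V : Space d → ℝ) (ρ : Measure (Space d)) (f : Space d → ℝ) : ℝ :=
  ∫ x, inner ℝ (gradient f x) (velocity V ρ x) ∂ρ

theorem continuous_velocity (hV : GrowthAssumption V) {ρ : Measure (Space d)}
    [IsProbabilityMeasure ρ] (hw : Integrable (fun x => 1 + V x) ρ) :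
    Continuous (velocity V ρ) := by
  have : velocity V ρ = fun x => velocityLinear V ρ x + velocityConst V ρ :=
    funext fun x => velocity_eq hV hw x
  rw [this]
  fun_prop

theorem Admissible.norm_inner_velocity_le (hV : GrowthAssumption V) {f : Space d → ℝ} {C : ℝ}
    (hf : Admissible V f C) {C₁ : ℝ} (hC₁ : 0 < C₁)
    (h1 : ∀ x, ‖gradient V x‖ ≤ C₁ * (1 + V x)) (h2 : ∀ x, ‖gradientOuter V x‖ ≤ C₁ * (1 + V x))
    {ρ : Measure (Space d)} [IsProbabilityMeasure ρ] (hw : Integrable (fun x => 1 + V x) ρ) {B : ℝ}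
    (hB : ∫ x, (1 + V x) ∂ρ ≤ B) (x : Space d) :
    ‖(inner ℝ (gradient f x) (velocity V ρ x) : ℝ)‖ ≤ ((1 + C₁ * B) * C) * (1 + V x) := by
  have h3 := norm_velocity_le hV hw h1 h2 x
  have h4 := hf.grad x
  have h5 : 0 ≤ ∫ x, (1 + V x) ∂ρ := integral_nonneg fun x => by
    simp only [Pi.zero_apply]; linarith [hV.nonneg x]
  have h6 : 0 ≤ 1 + C₁ * B := by nlinarith
  calc _ ≤ ‖gradient f x‖ * ‖velocity V ρ x‖ := norm_inner_le_norm _ _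
    _ ≤ ‖gradient f x‖ * ((1 + C₁ * B) * (1 + ‖x‖)) := by
        gcongr
        refine h3.trans ?_
        gcongr
    _ = (1 + C₁ * B) * ((1 + ‖x‖) * ‖gradient f x‖) := by ring
    _ ≤ (1 + C₁ * B) * (C * (1 + V x)) := by gcongr
    _ = _ := by ring

/-- The rate is a polynomial in integrals of fixed functions of the growth of `V`, each measurable in
time. -/
theorem IsWeakSolution.aestronglyMeasurable_rate (hV : GrowthAssumption V)
    (h : IsWeakSolution V ν μ) {f : Space d → ℝ} {C : ℝ} (hf : Admissible V f C) :
    AEStronglyMeasurable (fun t => rate V (μ t) f) (volume.restrict (Ioi 0)) := by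
  obtain ⟨C₁, -, hC₁⟩ := hV.exists_gradient_le
  have hgc := hf.continuous_gradient
  have hVc := (contDiff_gradient hV.smooth).continuous
  have h0 := h.aestronglyMeasurable_integral hV (f := fun x => inner ℝ (gradient f x) x)
    (by fun_prop) (C := C) fun x => by
      refine (norm_inner_le_norm _ _).trans ?_
      nlinarith [hf.grad x, norm_nonneg x, norm_nonneg (gradient f x)]
  have h1 : ∀ i j, AEStronglyMeasurable
      (fun t => ∫ x, x i * gradient f x j ∂(μ t : Measure (Space d))) (volume.restrict (Ioi 0)) :=
    fun i j => h.aestronglyMeasurable_integral hV (by fun_prop)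
      fun x => (abs_coord_mul_le hf.grad i j x).1
  have h2 : ∀ i j, AEStronglyMeasurable
      (fun t => ∫ x, x i * gradient V x j ∂(μ t : Measure (Space d))) (volume.restrict (Ioi 0)) :=
    fun i j => h.aestronglyMeasurable_integral hV (by fun_prop)
      fun x => (abs_coord_mul_le hC₁ i j x).1
  have h3 : ∀ j, AEStronglyMeasurable
      (fun t => ∫ x, gradient f x j ∂(μ t : Measure (Space d))) (volume.restrict (Ioi 0)) :=
    fun j => h.aestronglyMeasurable_integral hV (by fun_prop)
      fun x => (abs_coord_mul_le hf.grad j j x).2.1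
  have h4 : ∀ j, AEStronglyMeasurable
      (fun t => ∫ x, gradient V x j ∂(μ t : Measure (Space d))) (volume.restrict (Ioi 0)) :=
    fun j => h.aestronglyMeasurable_integral hV (by fun_prop)
      fun x => (abs_coord_mul_le hC₁ j j x).2.1
  refine ((h0.sub (Finset.aestronglyMeasurable_fun_sum Finset.univ fun j _ =>
    Finset.aestronglyMeasurable_fun_sum Finset.univ fun i _ => (h1 i j).mul (h2 i j))).sub
    (Finset.aestronglyMeasurable_fun_sum Finset.univ fun j _ => (h3 j).mul (h4 j))).congr ?_
  refine (ae_restrict_iff' measurableSet_Ioi).2 (Eventually.of_forall fun t ht => ?_)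
  exact (integral_inner_velocity hV (h.integrable hV (le_of_lt ht)) hgc hf.grad).symm

theorem IsWeakSolution.exists_rate_le (hV : GrowthAssumption V) (h : IsWeakSolution V ν μ)
    {T : ℝ} (hT : 0 < T) {C : ℝ} : ∃ B, 0 ≤ B ∧
      ∀ f, Admissible V f C → ∀ t ∈ Icc 0 T,
        (∀ x, ‖(inner ℝ (gradient f x) (velocity V (μ t) x) : ℝ)‖ ≤ B * (1 + V x)) ∧
        ‖rate V (μ t) f‖ ≤ B * B := by
  obtain ⟨C₁, hC₁, h1⟩ := hV.exists_gradient_bounds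
  obtain ⟨B, hB0, hB⟩ := h.exists_integral_le hV hT
  have hle := le_max_right B ((1 + C₁ * B) * |C|)
  have hle' := le_max_left B ((1 + C₁ * B) * |C|)
  set B' := max B ((1 + C₁ * B) * |C|)
  have hB'0 := hB0.trans hle'
  have hint : ∀ t ∈ Icc 0 T, ∫ x, B' * (1 + V x) ∂(μ t : Measure (Space d)) ≤ B' * B' := by
    intro t ht
    rw [integral_const_mul]
    gcongr
    exact (hB t ht).2.trans hle'
  refine ⟨B', hB'0, fun f hf t ht => ?_⟩
  have hpt : ∀ x, ‖(inner ℝ (gradient f x) (velocity V (μ t) x) : ℝ)‖ ≤ B' * (1 + V x) := by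
    intro x
    refine (hf.norm_inner_velocity_le hV hC₁ (fun x => (h1 x).2.1) (fun x => (h1 x).2.2)
      (hB t ht).1 (hB t ht).2 x).trans ?_
    have := hV.nonneg x
    gcongr
    refine le_trans ?_ hle
    gcongr
    exact le_abs_self C
  refine ⟨hpt, (norm_integral_le_of_norm_le ((hB t ht).1.const_mul _)
    (Eventually.of_forall hpt)).trans (hint t ht)⟩

/-- The integrated equation for compactly supported `f`, from the test functions `η(t) f(x)`. -/
theorem IsWeakSolution.sub_eq_integral_rate_of_hasCompactSupport (hV : GrowthAssumption V)
    (h : IsWeakSolution V ν μ) {f : Space d → ℝ} {C : ℝ} (hf : Admissible V f C)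
    (hfc : HasCompactSupport f) {t : ℝ} (ht : 0 ≤ t) :
    (∫ x, f x ∂(μ t : Measure (Space d))) - ∫ x, f x ∂(μ 0 : Measure (Space d))
      = ∫ s in (0 : ℝ)..t, rate V (μ s) f := by
  obtain ⟨D, hD⟩ := hfc.exists_bound_of_continuous hf.smooth.continuous
  refine sub_eq_integral_of_weak (F := fun t => ∫ x, f x ∂(μ t : Measure (Space d)))
    (h.continuousOn_integral_of_bounded hf.smooth.continuous hD)
    (h.aestronglyMeasurable_rate hV hf) (fun T hT => ?_) (fun η hη hηc => ?_) ht
  · obtain ⟨B, -, hB⟩ := h.exists_rate_le hV hT (C := C)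
    exact ⟨B * B, fun t ht => (hB f hf t ⟨ht.1.le, ht.2⟩).2⟩
  · have hφ := h.equation (fun z => η z.1 * f z.2)
      ((hη.comp contDiff_fst).mul (hf.smooth.comp contDiff_snd)) (by
        refine HasCompactSupport.of_support_subset_isCompact
          (IsCompact.prod (s := tsupport η) (t := tsupport f) hηc hfc) fun z hz => ?_
        exact ⟨subset_tsupport _ (left_ne_zero_of_mul hz),
          subset_tsupport _ (right_ne_zero_of_mul hz)⟩)
    rw [← h.initial] at hφ
    simp only [integral_const_mul] at hφ
    refine Eq.trans ?_ hφ
    congr 1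
    refine setIntegral_congr_fun measurableSet_Ioi fun t ht => ?_
    have ht0 : (0 : ℝ) ≤ t := le_of_lt ht
    have hi := h.integrable hV ht0
    obtain ⟨B, -, hB⟩ := h.exists_rate_le hV (show 0 < t + 1 by linarith) (C := C)
    have hg : ∀ x, gradient (fun z => η t * f z) x = η t • gradient f x := fun x => by
      rw [gradient, fderiv_const_mul (hf.smooth.differentiable (by simp) x), map_smul]
      rfl
    have hdη : ∀ x, deriv (fun s => η s * f x) t = deriv η t * f x := fun x =>
      deriv_mul_const (hη.differentiable (by simp) t) _
    simp only [hg, hdη, real_inner_smul_left]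
    have hvc := continuous_velocity hV hi
    have hgc := hf.continuous_gradient
    rw [integral_add ((integrable_of_norm_le hi hf.smooth.continuous hf.bound).const_mul _)
      ((integrable_of_norm_le hi (by fun_prop) (hB f hf t ⟨ht0, by linarith⟩).1).const_mul _),
      integral_const_mul, integral_const_mul]
    rfl

/-- The integrated equation passes to the limit along cutoffs, by dominated convergence in `x` and
then in time. -/
theorem IsWeakSolution.sub_eq_integral_rate (hV : GrowthAssumption V)
    (h : IsWeakSolution V ν μ) {f : Space d → ℝ} {C : ℝ} (hf : Admissible V f C)
    {t : ℝ} (ht : 0 ≤ t) :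
    (∫ x, f x ∂(μ t : Measure (Space d))) - ∫ x, f x ∂(μ 0 : Measure (Space d))
      = ∫ s in (0 : ℝ)..t, rate V (μ s) f := by
  obtain ⟨C', F, hF, hFc, hlim⟩ := hf.exists_approx
  have hm : ∀ s, 0 ≤ s → Tendsto (fun n => ∫ x, F n x ∂(μ s : Measure (Space d))) atTop
      (𝓝 (∫ x, f x ∂(μ s : Measure (Space d)))) := fun s hs => by
    refine tendsto_integral_of_dominated_convergence (fun x => C' * (1 + V x))
      (fun n => (hF n).smooth.continuous.aestronglyMeasurable) ((h.integrable hV hs).const_mul _)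
      (fun n => Eventually.of_forall (hF n).bound) (Eventually.of_forall fun x => ?_)
    exact tendsto_const_nhds.congr' ((hlim x).mono fun n hn => hn.self_of_nhds.symm)
  obtain ⟨B, -, hB⟩ := h.exists_rate_le hV (show 0 < t + 1 by linarith) (C := C')
  have hr : Tendsto (fun n => ∫ s in (0 : ℝ)..t, rate V (μ s) (F n)) atTop
      (𝓝 (∫ s in (0 : ℝ)..t, rate V (μ s) f)) := by
    refine intervalIntegral.tendsto_integral_filter_of_dominated_convergence (fun _ => B * B)
      (Eventually.of_forall fun n => ?_) (Eventually.of_forall fun n =>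
        Eventually.of_forall fun s hs => ?_) intervalIntegrable_const
      (Eventually.of_forall fun s hs => ?_)
    · rw [uIoc_of_le ht]
      exact (h.aestronglyMeasurable_rate hV (hF n)).mono_set Ioc_subset_Ioi_self
    · rw [uIoc_of_le ht] at hs
      exact (hB (F n) (hF n) s ⟨hs.1.le, by linarith [hs.2]⟩).2
    · rw [uIoc_of_le ht] at hs
      have hi := h.integrable hV hs.1.le
      have hvc := continuous_velocity hV hi
      refine tendsto_integral_of_dominated_convergence (fun x => B * (1 + V x))
        (fun n => ?_) (hi.const_mul _)
        (fun n => Eventually.of_forall (hB (F n) (hF n) s ⟨hs.1.le, by linarith [hs.2]⟩).1)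
        (Eventually.of_forall fun x => ?_)
      · have := (hF n).continuous_gradient
        exact Continuous.aestronglyMeasurable (by fun_prop)
      · exact tendsto_const_nhds.congr' ((hlim x).mono fun n hn => by simp only [hn.gradient_eq])
  refine tendsto_nhds_unique ((hm t ht).sub (hm 0 le_rfl)) (hr.congr fun n => ?_)
  exact (h.sub_eq_integral_rate_of_hasCompactSupport hV (hF n) (hFc n) ht).symm

end

/-! ### Continuity in time and the energy estimate -/

section
variable {d : ℕ} {V : Space d → ℝ} {ν : Measure (Space d)}
  {μ : ℝ → ProbabilityMeasure (Space d)}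

/-- Testing with `V` itself: the mean of `V` is the primitive of a bounded function. -/
theorem IsWeakSolution.continuousOn_integral_potential (hV : GrowthAssumption V)
    (h : IsWeakSolution V ν μ) :
    ContinuousOn (fun t => ∫ x, (1 + V x) ∂(μ t : Measure (Space d))) (Ici 0) := by
  obtain ⟨C, -, hC⟩ := hV.exists_admissible
  have hVi : ∀ t, 0 ≤ t → Integrable V (μ t : Measure (Space d)) := fun t ht =>
    integrable_of_norm_le (h.integrable hV ht) hC.smooth.continuous hC.bound
  have key : ContinuousOn (fun t => 1 + ∫ x, V x ∂(μ 0 : Measure (Space d))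
      + ∫ s in (0 : ℝ)..t, rate V (μ s) V) (Ici 0) := by
    intro t ht
    have ht' : (0 : ℝ) ≤ t := ht
    obtain ⟨B, -, hB⟩ := h.exists_rate_le hV (show 0 < t + 1 by linarith) (C := C)
    have hint : IntegrableOn (fun s => rate V (μ s) V) (uIcc 0 (t + 1)) := by
      rw [uIcc_of_le (by linarith), integrableOn_Icc_iff_integrableOn_Ioc]
      exact Integrable.of_bound
        ((h.aestronglyMeasurable_rate hV hC).mono_set Ioc_subset_Ioi_self) (B * B)
        ((ae_restrict_iff' measurableSet_Ioc).2 (Eventually.of_forall fun s hs =>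
          (hB V hC s ⟨hs.1.le, hs.2⟩).2))
    have hp := intervalIntegral.continuousOn_primitive_interval hint
    rw [uIcc_of_le (by linarith)] at hp
    refine continuousWithinAt_const.add ((hp t ⟨ht', by linarith⟩).mono_of_mem_nhdsWithin ?_)
    rw [← Ici_inter_Iic]
    exact inter_mem self_mem_nhdsWithin (mem_nhdsWithin_of_mem_nhds (Iic_mem_nhds (by linarith)))
  refine key.congr fun t ht => ?_
  have h1 := h.sub_eq_integral_rate hV hC (t := t) ht
  simp only
  rw [integral_add (integrable_const _) (hVi t ht), integral_const, probReal_univ, one_smul, ← h1]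
  ring

/-- Continuity of `∫ (1 + V) dμ_t` gives uniform integrability of `V` in time, so that narrow
continuity extends to functions of the growth of `V`. -/
theorem IsWeakSolution.continuousOn_integral (hV : GrowthAssumption V)
    (h : IsWeakSolution V ν μ) {f : Space d → ℝ} (hf : Continuous f) {C : ℝ}
    (hC : ∀ x, ‖f x‖ ≤ C * (1 + V x)) :
    ContinuousOn (fun t => ∫ x, f x ∂(μ t : Measure (Space d))) (Ici 0) := by
  have hVc := hV.smooth.continuous
  have hw : ∀ x, 0 < 1 + V x := fun x => by linarith [hV.nonneg x]
  have hC0 : 0 ≤ C :=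
    nonneg_of_mul_nonneg_left ((norm_nonneg _).trans (hC 0)) (hw 0)
  intro s hs
  -- the integral of the part of the weight above level `n`
  let e : ℕ → ℝ → ℝ := fun n t => (∫ x, (1 + V x) ∂(μ t : Measure (Space d)))
    - ∫ x, min (1 + V x) n ∂(μ t : Measure (Space d))
  have hmin : ∀ (n : ℕ) x, ‖min (1 + V x) (n : ℝ)‖ ≤ n := fun n x => by
    rw [Real.norm_eq_abs, abs_of_nonneg (le_min (hw x).le n.cast_nonneg)]
    exact min_le_right _ _
  have hminI : ∀ (n : ℕ) t, Integrable (fun x => min (1 + V x) (n : ℝ)) (μ t : Measure (Space d)) :=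
    fun n t => Integrable.of_bound (by fun_prop) n (Eventually.of_forall (hmin n))
  have he : ∀ n, ContinuousOn (e n) (Ici 0) := fun n =>
    (h.continuousOn_integral_potential hV).sub
      (h.continuousOn_integral_of_bounded (by fun_prop) (hmin n))
  have helim : Tendsto (fun n => e n s) atTop (𝓝 0) := by
    have : Tendsto (fun n : ℕ => ∫ x, min (1 + V x) (n : ℝ) ∂(μ s : Measure (Space d))) atTop
        (𝓝 (∫ x, (1 + V x) ∂(μ s : Measure (Space d)))) := by
      refine tendsto_integral_of_dominated_convergence (fun x => 1 + V x)
        (fun n => Continuous.aestronglyMeasurable (by fun_prop)) (h.integrable hV hs)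
        (fun n => Eventually.of_forall fun x => ?_) (Eventually.of_forall fun x => ?_)
      · rw [Real.norm_eq_abs, abs_of_nonneg (le_min (hw x).le n.cast_nonneg)]
        exact min_le_left _ _
      · obtain ⟨N, hN⟩ := exists_nat_ge (1 + V x)
        refine tendsto_const_nhds.congr' ?_
        filter_upwards [eventually_ge_atTop N] with n hn
        exact (min_eq_left (hN.trans (by exact_mod_cast hn))).symm
    simpa [e] using this.const_sub (∫ x, (1 + V x) ∂(μ s : Measure (Space d)))
  -- the truncation error is controlled by `e n t`, which is small near `s` for a fixed large `n`
  have herr : ∀ n : ℕ, ∀ t, 0 ≤ t → ‖(∫ x, f x ∂(μ t : Measure (Space d)))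
      - ∫ x, trunc (C * n) (f x) ∂(μ t : Measure (Space d))‖ ≤ C * e n t := by
    intro n t ht
    have hi := h.integrable hV ht
    have hfi := integrable_of_norm_le hi hf hC
    have hti : Integrable (fun x => trunc (C * n) (f x)) (μ t : Measure (Space d)) :=
      Integrable.of_bound ((continuous_trunc _).comp hf).aestronglyMeasurable (C * n)
        (Eventually.of_forall fun x => abs_trunc_le (by positivity) _)
    rw [← integral_sub hfi hti]
    simp only [e]
    rw [← integral_sub hi (hminI n t), ← integral_const_mul]
    exact norm_integral_le_of_norm_le ((hi.sub (hminI n t)).const_mul C)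
      (Eventually.of_forall fun x => abs_sub_trunc_le hC0 n.cast_nonneg (hC x))
  rw [Metric.continuousWithinAt_iff']
  intro δ hδ
  obtain ⟨n, hn⟩ := ((helim.const_mul C).eventually
    (gt_mem_nhds (show C * 0 < δ / 3 by rw [mul_zero]; positivity))).exists
  have h1 : ∀ᶠ t in 𝓝[Ici 0] s, C * e n t < δ / 3 :=
    ((he n s hs).const_smul C).eventually (gt_mem_nhds hn)
  have h2 := h.continuousOn_integral_of_bounded ((continuous_trunc (C * n)).comp hf)
    (C := C * n) (fun x => abs_trunc_le (by positivity) _) s hs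
  have h3 := Metric.continuousWithinAt_iff'.1 h2 (δ / 3) (by positivity)
  filter_upwards [h1, h3, self_mem_nhdsWithin] with t ht1 ht3 ht0
  have h4 := herr n t ht0
  have h5 := herr n s hs
  rw [Real.dist_eq] at ht3 ⊢
  rw [Real.norm_eq_abs] at h4 h5
  simp only [Function.comp_apply] at ht3
  rw [abs_lt] at ht3 ⊢
  rw [abs_le] at h4 h5
  constructor <;> linarith

theorem IsWeakSolution.continuousOn_integral_vector (hV : GrowthAssumption V)
    (h : IsWeakSolution V ν μ) {f : Space d → Space d} (hf : Continuous f) {C : ℝ}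
    (hC : ∀ x, ‖f x‖ ≤ C * (1 + V x)) :
    ContinuousOn (fun t => ∫ x, f x ∂(μ t : Measure (Space d))) (Ici 0) := by
  have key : ContinuousOn (fun t => WithLp.toLp 2
      (fun j => ∫ x, f x j ∂(μ t : Measure (Space d)))) (Ici 0) := by
    refine (PiLp.continuous_toLp 2 _).comp_continuousOn (continuousOn_pi.2 fun j => ?_)
    exact h.continuousOn_integral hV (by fun_prop) fun x => (PiLp.norm_apply_le _ j).trans (hC x)
  refine key.congr fun t ht => ?_
  ext j
  exact ((EuclideanSpace.proj (𝕜 := ℝ) j).integral_comp_comm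
    (integrable_of_norm_le (h.integrable hV ht) hf hC)).symm

theorem IsWeakSolution.continuousOn_velocityConst (hV : GrowthAssumption V)
    (h : IsWeakSolution V ν μ) : ContinuousOn (fun t => velocityConst V (μ t)) (Ici 0) := by
  obtain ⟨C, -, hC⟩ := hV.exists_gradient_bounds
  exact (h.continuousOn_integral_vector hV (contDiff_gradient hV.smooth).continuous
    fun x => (hC x).2.1).neg

theorem IsWeakSolution.continuousOn_velocityLinear (hV : GrowthAssumption V)
    (h : IsWeakSolution V ν μ) : ContinuousOn (fun t => velocityLinear V (μ t)) (Ici 0) := by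
  obtain ⟨C, -, hC⟩ := hV.exists_gradient_bounds
  have hOc := continuous_gradientOuter hV.smooth
  refine continuousOn_const.sub (continuousOn_clm_apply.2 fun v => ?_)
  refine (h.continuousOn_integral_vector hV (f := fun y => gradientOuter V y v) (by fun_prop)
    (C := C * ‖v‖) fun x => ?_).congr fun t ht => ?_
  · refine (ContinuousLinearMap.le_opNorm _ _).trans ?_
    calc _ ≤ (C * (1 + V x)) * ‖v‖ := by gcongr; exact (hC x).2.2
      _ = _ := by ring
  · exact ContinuousLinearMap.integral_apply (integrable_gradientOuter hV (h.integrable hV ht)) v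

theorem IsWeakSolution.continuousOn_rate (hV : GrowthAssumption V)
    (h : IsWeakSolution V ν μ) {f : Space d → ℝ} {C : ℝ} (hf : Admissible V f C) :
    ContinuousOn (fun t => rate V (μ t) f) (Ici 0) := by
  obtain ⟨C₁, -, hC₁⟩ := hV.exists_gradient_le
  have hgc := hf.continuous_gradient
  have hVc := (contDiff_gradient hV.smooth).continuous
  have h0 := h.continuousOn_integral hV (f := fun x => inner ℝ (gradient f x) x)
    (by fun_prop) (C := C) fun x => by
      refine (norm_inner_le_norm _ _).trans ?_
      nlinarith [hf.grad x, norm_nonneg x, norm_nonneg (gradient f x)]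
  have h1 : ∀ {g : Space d → Space d} {D : ℝ}, Continuous g →
      (∀ x, (1 + ‖x‖) * ‖g x‖ ≤ D * (1 + V x)) → ∀ i j,
      ContinuousOn (fun t => ∫ x, x i * g x j ∂(μ t : Measure (Space d))) (Ici 0) ∧
      ContinuousOn (fun t => ∫ x, g x j ∂(μ t : Measure (Space d))) (Ici 0) :=
    fun hgc hg i j =>
      ⟨h.continuousOn_integral hV (by fun_prop) fun x => (abs_coord_mul_le hg i j x).1,
        h.continuousOn_integral hV (by fun_prop) fun x => (abs_coord_mul_le hg i j x).2.1⟩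
  refine ContinuousOn.congr ((h0.sub (continuousOn_finsetSum Finset.univ fun j _ =>
    continuousOn_finsetSum Finset.univ fun i _ =>
      (h1 hgc hf.grad i j).1.mul (h1 hVc hC₁ i j).1)).sub
    (continuousOn_finsetSum Finset.univ fun j _ =>
      (h1 hgc hf.grad j j).2.mul (h1 hVc hC₁ j j).2)) fun t ht => ?_
  exact integral_inner_velocity hV (h.integrable hV ht) hgc hf.grad

theorem IsWeakSolution.hasDerivWithinAt_integral (hV : GrowthAssumption V)
    (h : IsWeakSolution V ν μ) {f : Space d → ℝ} {C : ℝ} (hf : Admissible V f C) {t : ℝ}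
    (ht : 0 ≤ t) : HasDerivWithinAt (fun t => ∫ x, f x ∂(μ t : Measure (Space d)))
      (rate V (μ t) f) (Ici t) t := by
  have hc := h.continuousOn_rate hV hf
  have hsub : Ici t ⊆ Ici 0 := Ici_subset_Ici.2 ht
  have h1 : HasDerivWithinAt (fun t => ∫ s in (0 : ℝ)..t, rate V (μ s) f)
      (rate V (μ t) f) (Ici t) t := by
    refine intervalIntegral.integral_hasDerivWithinAt_right (t := Ioi t) ?_ ?_ ?_
    · refine ContinuousOn.intervalIntegrable (hc.mono ?_)
      rw [uIcc_of_le ht]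
      exact Icc_subset_Ici_self
    · exact (hc.mono (Ioi_subset_Ici_self.trans hsub)).stronglyMeasurableAtFilter_nhdsWithin
        measurableSet_Ioi t
    · exact (hc t ht).mono (Ioi_subset_Ici_self.trans hsub)
  refine (h1.const_add (∫ x, f x ∂(μ 0 : Measure (Space d)))).congr (fun s hs => ?_) ?_
  · rw [← h.sub_eq_integral_rate hV hf (hsub hs)]; ring
  · rw [← h.sub_eq_integral_rate hV hf ht]; ring

/-- Positivity of the kernel: the interaction can only decrease the energy, and the repulsion term
costs at most `C (1 + V)`. -/
theorem rate_potential_le (hV : GrowthAssumption V) {C : ℝ}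
    (hC : ∀ x, (1 + ‖x‖) * ‖gradient V x‖ ≤ C * (1 + V x)) {ρ : Measure (Space d)}
    [IsProbabilityMeasure ρ] (hw : Integrable (fun x => 1 + V x) ρ) :
    rate V ρ V ≤ C * ∫ x, (1 + V x) ∂ρ := by
  have hVc := (contDiff_gradient hV.smooth).continuous
  rw [rate, integral_inner_velocity hV hw hVc hC]
  have h1 : 0 ≤ ∑ j, ∑ i, (∫ x, x i * gradient V x j ∂ρ) * ∫ x, x i * gradient V x j ∂ρ :=
    Finset.sum_nonneg fun j _ => Finset.sum_nonneg fun i _ => mul_self_nonneg _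
  have h2 : 0 ≤ ∑ j, (∫ x, gradient V x j ∂ρ) * ∫ x, gradient V x j ∂ρ :=
    Finset.sum_nonneg fun j _ => mul_self_nonneg _
  have h3 : ‖∫ x, (inner ℝ (gradient V x) x : ℝ) ∂ρ‖ ≤ C * ∫ x, (1 + V x) ∂ρ :=
    norm_integral_le_mul hw fun x => by
      refine (norm_inner_le_norm _ _).trans ?_
      nlinarith [hC x, norm_nonneg x, norm_nonneg (gradient V x)]
  linarith [(Real.le_norm_self _).trans h3]

/-- The energy estimate: Gronwall's lemma for the mean of `1 + V`. -/
theorem IsWeakSolution.integral_potential_le (hV : GrowthAssumption V)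
    (h : IsWeakSolution V ν μ) {C : ℝ}
    (hC : ∀ x, (1 + ‖x‖) * ‖gradient V x‖ ≤ C * (1 + V x)) {t : ℝ} (ht : 0 ≤ t) :
    ∫ x, (1 + V x) ∂(μ t : Measure (Space d))
      ≤ (∫ x, (1 + V x) ∂(μ 0 : Measure (Space d))) * Real.exp (C * t) := by
  obtain ⟨C', -, hC'⟩ := hV.exists_admissible
  have hderiv : ∀ s, 0 ≤ s → HasDerivWithinAt
      (fun t => ∫ x, (1 + V x) ∂(μ t : Measure (Space d))) (rate V (μ s) V) (Ici s) s := by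
    intro s hs
    have h1 : ∀ r, 0 ≤ r → ∫ x, (1 + V x) ∂(μ r : Measure (Space d))
        = 1 + ∫ x, V x ∂(μ r : Measure (Space d)) := fun r hr => by
      rw [integral_add (integrable_const _)
        (integrable_of_norm_le (h.integrable hV hr) hV.smooth.continuous hC'.bound),
        integral_const, probReal_univ, one_smul]
    exact ((h.hasDerivWithinAt_integral hV hC' hs).const_add 1).congr
      (fun r hr => h1 r (hs.trans hr)) (h1 s hs)
  have key := le_gronwallBound_of_liminf_deriv_right_le (a := 0) (b := t) (K := C) (ε := 0)
    (f' := fun s => rate V (μ s) V)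
    ((h.continuousOn_integral_potential hV).mono Icc_subset_Ici_self)
    (fun s hs r hr => (hderiv s hs.1).liminf_right_slope_le hr) le_rfl
    (fun s hs => by
      rw [add_zero]; exact rate_potential_le hV hC (h.integrable hV hs.1)) t ⟨ht, le_rfl⟩
  rwa [gronwallBound_ε0, sub_zero] at key

end

/-! ### Representation of weak solutions by the affine flow -/

section
variable {d : ℕ} {V : Space d → ℝ} {ν : Measure (Space d)}
  {μ : ℝ → ProbabilityMeasure (Space d)}

/-- Smooth compactly supported functions separate finite measures: compare the densities with
respect to the sum. -/
theorem eq_of_forall_integral_contDiff_eq {E : Type*} [NormedAddCommGroup E] [NormedSpace ℝ E]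
    [FiniteDimensional ℝ E] [MeasurableSpace E] [BorelSpace E] {μ₁ μ₂ : Measure E}
    [IsFiniteMeasure μ₁] [IsFiniteMeasure μ₂] (h : ∀ ψ : E → ℝ, ContDiff ℝ ∞ ψ → HasCompactSupport ψ →
      ∫ x, ψ x ∂μ₁ = ∫ x, ψ x ∂μ₂) : μ₁ = μ₂ := by
  obtain ⟨lam, _, h1, h2⟩ : ∃ lam : Measure E, IsFiniteMeasure lam ∧ μ₁ ≪ lam ∧ μ₂ ≪ lam :=
    ⟨μ₁ + μ₂, inferInstance, Measure.AbsolutelyContinuous.rfl.add_right _, by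
      rw [add_comm]; exact Measure.AbsolutelyContinuous.rfl.add_right _⟩
  have key := ae_eq_of_integral_contDiff_smul_eq (μ := lam)
    (f := fun x => (μ₁.rnDeriv lam x).toReal) (f' := fun x => (μ₂.rnDeriv lam x).toReal)
    Measure.integrable_toReal_rnDeriv.locallyIntegrable
    Measure.integrable_toReal_rnDeriv.locallyIntegrable (fun ψ hψ hψc => by
      have e1 := integral_rnDeriv_smul h1 (f := ψ)
      have e2 := integral_rnDeriv_smul h2 (f := ψ)
      simp only [smul_eq_mul] at e1 e2 ⊢
      simp only [mul_comm (ψ _)]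
      rw [e1, e2, h ψ hψ hψc])
  rw [← Measure.withDensity_rnDeriv_eq _ _ h1, ← Measure.withDensity_rnDeriv_eq _ _ h2]
  refine withDensity_congr_ae ?_
  filter_upwards [key, Measure.rnDeriv_lt_top μ₁ lam, Measure.rnDeriv_lt_top μ₂ lam]
    with x hx hx1 hx2
  exact (ENNReal.toReal_eq_toReal_iff' hx1.ne hx2.ne).1 hx

theorem eventually_forall_abs_sub_le {g : ℝ × Space d → ℝ} (hg : Continuous g) {T : ℝ}
    {S : Set (Space d)} (hS : IsCompact S) (h0 : ∀ r ∈ Icc 0 T, ∀ x ∉ S, g (r, x) = 0) {s : ℝ}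
    (hs : s ∈ Icc 0 T) {ε : ℝ} (hε : 0 < ε) :
    ∀ᶠ r in 𝓝[Icc 0 T] s, ∀ x, |g (r, x) - g (s, x)| ≤ ε := by
  have huc := ((isCompact_Icc (a := (0 : ℝ)) (b := T)).prod hS).uniformContinuousOn_of_continuous
    hg.continuousOn
  obtain ⟨δ, hδ, h⟩ := Metric.uniformContinuousOn_iff.1 huc ε hε
  filter_upwards [self_mem_nhdsWithin, mem_nhdsWithin_of_mem_nhds (Metric.ball_mem_nhds s hδ)]
    with r hr hrs x
  by_cases hx : x ∈ S
  · have h1 := h (r, x) ⟨hr, hx⟩ (s, x) ⟨hs, hx⟩ (by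
      rw [Prod.dist_eq, dist_self, max_eq_left dist_nonneg]; exact hrs)
    rw [Real.dist_eq] at h1
    exact h1.le
  · rw [h0 r hr x hx, h0 s hs x hx, sub_zero, abs_zero]
    exact hε.le

theorem exists_bound_of_support {g : ℝ × Space d → ℝ} (hg : Continuous g) {T : ℝ}
    {S : Set (Space d)} (hS : IsCompact S) (h0 : ∀ r ∈ Icc 0 T, ∀ x ∉ S, g (r, x) = 0) {s : ℝ}
    (hs : s ∈ Icc 0 T) : ∃ M, ∀ x, ‖g (s, x)‖ ≤ M := by
  obtain ⟨M, hM⟩ := hS.exists_bound_of_continuousOn (f := fun x => g (s, x)) (by fun_prop)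
  refine ⟨max M 0, fun x => ?_⟩
  by_cases hx : x ∈ S
  · exact (hM x hx).trans (le_max_left _ _)
  · rw [h0 s hs x hx, norm_zero]; exact le_max_right _ _

theorem integrable_of_support {g : ℝ × Space d → ℝ} (hg : Continuous g) {T : ℝ}
    {S : Set (Space d)} (hS : IsCompact S) (h0 : ∀ r ∈ Icc 0 T, ∀ x ∉ S, g (r, x) = 0) {s : ℝ}
    (hs : s ∈ Icc 0 T) (ρ : Measure (Space d)) [IsFiniteMeasure ρ] :
    Integrable (fun x => g (s, x)) ρ := by
  obtain ⟨M, hM⟩ := exists_bound_of_support hg hS h0 hs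
  exact Integrable.of_bound (Continuous.aestronglyMeasurable (by fun_prop)) M
    (Eventually.of_forall hM)

theorem IsWeakSolution.continuousOn_integral_moving (h : IsWeakSolution V ν μ)
    {g : ℝ × Space d → ℝ} (hg : Continuous g) {T : ℝ}
    {S : Set (Space d)} (hS : IsCompact S) (h0 : ∀ r ∈ Icc 0 T, ∀ x ∉ S, g (r, x) = 0) :
    ContinuousOn (fun t => ∫ x, g (t, x) ∂(μ t : Measure (Space d))) (Icc 0 T) := by
  intro s hs
  rw [Metric.continuousWithinAt_iff']
  intro ε hε
  obtain ⟨M, hM⟩ := exists_bound_of_support hg hS h0 hs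
  have h1 := Metric.continuousWithinAt_iff'.1
    ((h.continuousOn_integral_of_bounded (f := fun x => g (s, x)) (by fun_prop) hM s hs.1).mono
      (Icc_subset_Ici_self (a := T))) (ε / 2) (by positivity)
  filter_upwards [h1, eventually_forall_abs_sub_le hg hS h0 hs (show 0 < ε / 3 by positivity),
    self_mem_nhdsWithin] with t ht1 ht2 ht
  have h2 : ‖∫ x, (g (t, x) - g (s, x)) ∂(μ t : Measure (Space d))‖ ≤ ε / 3 := by
    refine (norm_integral_le_of_norm_le_const (Eventually.of_forall ht2)).trans ?_
    simp
  rw [integral_sub (integrable_of_support hg hS h0 ht _) (integrable_of_support hg hS h0 hs _),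
    ← dist_eq_norm] at h2
  exact (dist_triangle _ _ _).trans_lt (by linarith)

/-- The part of the derivative of `∫ F(t, x) dμ_t(x)` that comes from the dependence of `F` on time. -/
theorem IsWeakSolution.hasDerivWithinAt_moving (h : IsWeakSolution V ν μ)
    {F g : ℝ × Space d → ℝ} (hF : Continuous F) (hg : Continuous g) {T : ℝ}
    {S : Set (Space d)} (hS : IsCompact S) (hF0 : ∀ r ∈ Icc 0 T, ∀ x ∉ S, F (r, x) = 0)
    (h0 : ∀ r ∈ Icc 0 T, ∀ x ∉ S, g (r, x) = 0)
    (hFg : ∀ x, ∀ r ∈ Icc 0 T, HasDerivAt (fun r => F (r, x)) (g (r, x)) r)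
    {s : ℝ} (hs : s ∈ Ico 0 T) :
    HasDerivWithinAt (fun t => ∫ x, (F (t, x) - F (s, x)) ∂(μ t : Measure (Space d)))
      (∫ x, g (s, x) ∂(μ s : Measure (Space d))) (Ici s) s := by
  have hs' : s ∈ Icc 0 T := ⟨hs.1, hs.2.le⟩
  rw [hasDerivWithinAt_iff_isLittleO, Asymptotics.isLittleO_iff]
  intro ε hε
  obtain ⟨M, hM⟩ := exists_bound_of_support hg hS h0 hs'
  have h1 := Metric.continuousWithinAt_iff'.1
    ((h.continuousOn_integral_of_bounded (f := fun x => g (s, x)) (by fun_prop) hM s hs.1).mono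
      (Ici_subset_Ici.2 hs.1)) (ε / 2) (by positivity)
  obtain ⟨δ, hδ, hball⟩ := Metric.mem_nhdsWithin_iff.1
    (eventually_forall_abs_sub_le hg hS h0 hs' (show 0 < ε / 2 by positivity))
  filter_upwards [h1, self_mem_nhdsWithin, mem_nhdsWithin_of_mem_nhds (Metric.ball_mem_nhds s hδ),
    mem_nhdsWithin_of_mem_nhds (Iic_mem_nhds hs.2)] with t ht1 hts htδ htT
  have hts' : s ≤ t := hts
  have htT' : t ≤ T := htT
  have ht : t ∈ Icc 0 T := ⟨hs.1.trans hts', htT'⟩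
  have hpt : ∀ x, ‖(F (t, x) - F (s, x)) - (t - s) * g (s, x)‖ ≤ ε / 2 * (t - s) := by
    intro x
    have h2 := norm_image_sub_le_of_norm_deriv_le_segment'
      (f := fun r => F (r, x) - r * g (s, x)) (f' := fun r => g (r, x) - g (s, x)) (a := s) (b := t)
      (C := ε / 2) (fun r hr => by
        have hd := (hFg x r ⟨hs.1.trans hr.1, hr.2.trans htT'⟩).sub
          ((hasDerivAt_id r).mul_const (g (s, x)))
        rw [one_mul] at hd
        exact hd.hasDerivWithinAt) (fun r hr => by
        refine hball ⟨?_, hs.1.trans hr.1, hr.2.le.trans htT'⟩ x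
        rw [Metric.mem_ball, Real.dist_eq, abs_of_nonneg (sub_nonneg.2 hts')] at htδ
        rw [Metric.mem_ball, Real.dist_eq, abs_of_nonneg (sub_nonneg.2 hr.1)]
        linarith [hr.2]) t ⟨hts', le_rfl⟩
    calc _ = ‖(F (t, x) - t * g (s, x)) - (F (s, x) - s * g (s, x))‖ := by congr 1; ring
      _ ≤ _ := h2
  have hFi : Integrable (fun x => F (t, x) - F (s, x)) (μ t : Measure (Space d)) :=
    (integrable_of_support hF hS hF0 ht (μ t : Measure (Space d))).sub
    (integrable_of_support hF hS hF0 hs' (μ t : Measure (Space d)))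
  have h3 : ‖(∫ x, (F (t, x) - F (s, x)) ∂(μ t : Measure (Space d)))
      - (t - s) * ∫ x, g (s, x) ∂(μ t : Measure (Space d))‖ ≤ ε / 2 * (t - s) := by
    rw [← integral_const_mul, ← integral_sub hFi
      ((integrable_of_support hg hS h0 hs' (μ t : Measure (Space d))).const_mul _)]
    refine (norm_integral_le_of_norm_le_const (Eventually.of_forall hpt)).trans ?_
    simp
  have h4 : ‖(t - s) * ((∫ x, g (s, x) ∂(μ t : Measure (Space d)))
      - ∫ x, g (s, x) ∂(μ s : Measure (Space d)))‖ ≤ (t - s) * (ε / 2) := by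
    rw [norm_mul, Real.norm_eq_abs, abs_of_nonneg (sub_nonneg.2 hts'), ← dist_eq_norm]
    gcongr
  simp only [sub_self, integral_zero, sub_zero, smul_eq_mul]
  rw [Real.norm_eq_abs (t - s), abs_of_nonneg (sub_nonneg.2 hts')]
  calc _ = ‖((∫ x, (F (t, x) - F (s, x)) ∂(μ t : Measure (Space d)))
        - (t - s) * ∫ x, g (s, x) ∂(μ t : Measure (Space d)))
        + (t - s) * ((∫ x, g (s, x) ∂(μ t : Measure (Space d)))
        - ∫ x, g (s, x) ∂(μ s : Measure (Space d)))‖ := by congr 1; ring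
    _ ≤ ε / 2 * (t - s) + (t - s) * (ε / 2) := (norm_add_le _ _).trans (add_le_add h3 h4)
    _ = ε * (t - s) := by ring

/-- The solution is transported by the affine flow of its own velocity field. For a test function
`ψ`, the function `t ↦ ∫ ψ(Ψ_t x) dμ_t(x)` is constant, where `Ψ_t` is the inverse flow: its
derivative is the integral of the material derivative of `ψ ∘ Ψ_t`, which vanishes. -/
theorem IsWeakSolution.exists_flow (hV : GrowthAssumption V) (h : IsWeakSolution V ν μ) {T : ℝ}
    (hT : 0 < T) : ∃ (A : ℝ → Space d →L[ℝ] Space d) (a : ℝ → Space d), A 0 = 1 ∧ a 0 = 0 ∧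
      ∀ t ∈ Icc 0 T, HasDerivAt A (velocityLinear V (μ t) * A t) t ∧
        HasDerivAt a (velocityLinear V (μ t) (a t) + velocityConst V (μ t)) t ∧
        (μ t : Measure (Space d)) = (μ 0 : Measure (Space d)).map fun x => A t x + a t := by
  -- freeze the coefficients outside `[0, T]`, so that they are continuous and bounded
  let κ : ℝ → ℝ := fun t => max 0 (min t T)
  have hκ : ∀ t, κ t ∈ Icc 0 T := fun t =>
    ⟨le_max_left _ _, max_le hT.le (min_le_right _ _)⟩
  have hκid : ∀ t ∈ Icc 0 T, κ t = t := fun t ht => by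
    simp only [κ]; rw [min_eq_left ht.2, max_eq_right ht.1]
  have hκc : Continuous κ := by fun_prop
  set L : ℝ → Space d →L[ℝ] Space d := fun t => velocityLinear V (μ (κ t)) with hLdef
  set c : ℝ → Space d := fun t => velocityConst V (μ (κ t)) with hcdef
  have hL : Continuous L := (h.continuousOn_velocityLinear hV).comp_continuous hκc
    fun t => (hκ t).1
  have hc : Continuous c := (h.continuousOn_velocityConst hV).comp_continuous hκc
    fun t => (hκ t).1
  obtain ⟨K, hK⟩ := isCompact_Icc.exists_bound_of_continuousOn
    ((h.continuousOn_velocityLinear hV).mono (Icc_subset_Ici_self (a := T)))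
  obtain ⟨A, B, a, b, hAc, hBc, hac, hbc, hA0, hB0, ha0, hb0, hA, hB, ha, hb, hBA, hAB⟩ :=
    exists_affine_flow hL (fun t => hK (κ t) (hκ t)) hc
  have hmap : ∀ t ∈ Icc 0 T, (μ t : Measure (Space d)).map (fun x => B t x + b t)
      = (μ 0 : Measure (Space d)) := by
    intro t ht
    have hΨm : Measurable fun x => B t x + b t := by fun_prop
    have : IsFiniteMeasure ((μ t : Measure (Space d)).map fun x => B t x + b t) := by
      have := Measure.isProbabilityMeasure_map (μ := (μ t : Measure (Space d))) hΨm.aemeasurable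
      infer_instance
    refine eq_of_forall_integral_contDiff_eq fun ψ hψ hψc => ?_
    rw [integral_map hΨm.aemeasurable hψ.continuous.aestronglyMeasurable]
    let F : ℝ × Space d → ℝ := fun z => ψ (B z.1 z.2 + b z.1)
    let g : ℝ × Space d → ℝ := fun z =>
      -fderiv ℝ ψ (B z.1 z.2 + b z.1) (B z.1 (L z.1 z.2 + c z.1))
    have hψd : Continuous (fderiv ℝ ψ) := hψ.continuous_fderiv (by simp)
    have hΨc : Continuous fun z : ℝ × Space d => B z.1 z.2 + b z.1 := by fun_prop
    have hF : Continuous F := hψ.continuous.comp hΨc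
    have hg : Continuous g := ((hψd.comp hΨc).clm_apply (by fun_prop)).neg
    -- the test function carried along by the flow stays in a fixed compact set up to time `T`
    let S : Set (Space d) := (fun z : ℝ × Space d => A z.1 z.2 + a z.1) '' Icc 0 T ×ˢ tsupport ψ
    have hS : IsCompact S := (isCompact_Icc.prod hψc.isCompact).image (by fun_prop)
    have hout : ∀ r ∈ Icc 0 T, ∀ x ∉ S, B r x + b r ∉ tsupport ψ := fun r hr x hx hmem =>
      hx ⟨(r, B r x + b r), ⟨hr, hmem⟩, hAB r hr.1 x⟩
    have hF0 : ∀ r ∈ Icc 0 T, ∀ x ∉ S, F (r, x) = 0 := fun r hr x hx =>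
      image_eq_zero_of_notMem_tsupport (f := ψ) (hout r hr x hx)
    have hg0 : ∀ r ∈ Icc 0 T, ∀ x ∉ S, g (r, x) = 0 := fun r hr x hx => by
      have h1 : fderiv ℝ ψ (B r x + b r) = 0 := image_eq_zero_of_notMem_tsupport
        fun hmem => hout r hr x hx (tsupport_fderiv_subset ℝ hmem)
      simp only [g, h1, zero_apply, neg_zero]
    have hFg : ∀ x, ∀ r ∈ Icc 0 T, HasDerivAt (fun r => F (r, x)) (g (r, x)) r := by
      intro x r hr
      have h1 : HasDerivAt (fun r => B r x + b r) (-B r (L r x + c r)) r :=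
        (((hB r hr.1).clm_apply (hasDerivAt_const r x)).add (hb r)).congr_deriv (by
          simp; abel)
      have h2 := (hψ.differentiable (by simp) (B r x + b r)).hasFDerivAt.comp_hasDerivAt r h1
      rw [map_neg] at h2
      exact h2
    have hcont := h.continuousOn_integral_moving hF hS hF0
    have hconst := constant_of_has_deriv_right_zero hcont (fun s hs => by
      have hs' : s ∈ Icc 0 T := ⟨hs.1, hs.2.le⟩
      have hfs : ContDiff ℝ ∞ fun x => F (s, x) :=
        hψ.comp ((B s).contDiff.add (contDiff_const (c := b s)))
      have hfsc : HasCompactSupport fun x => F (s, x) :=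
        HasCompactSupport.intro hS fun x hx => hF0 s hs' x hx
      obtain ⟨C, hC⟩ := exists_admissible_of_hasCompactSupport hV hfs hfsc
      have h1 := h.hasDerivWithinAt_moving hF hg hS hF0 hg0 hFg hs
      have h2 := h.hasDerivWithinAt_integral hV hC hs.1
      -- the material derivative of `ψ ∘ Ψ_s` along the velocity vanishes
      have h3 : (∫ x, g (s, x) ∂(μ s : Measure (Space d))) + rate V (μ s) (fun x => F (s, x))
          = 0 := by
        rw [rate]
        have h4 : ∀ x, (inner ℝ (gradient (fun x => F (s, x)) x) (velocity V (μ s) x) : ℝ)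
            = -g (s, x) := by
          intro x
          rw [velocity_eq hV (h.integrable hV hs.1), inner_gradient_left]
          have h5 : HasFDerivAt (fun x => F (s, x)) ((fderiv ℝ ψ (B s x + b s)).comp (B s)) x :=
            (hψ.differentiable (by simp) (B s x + b s)).hasFDerivAt.comp x
              ((B s).hasFDerivAt.add_const (b s))
          rw [h5.fderiv]
          simp only [g, neg_neg, hLdef, hcdef, hκid s hs', ContinuousLinearMap.comp_apply]
        simp only [h4, integral_neg, add_neg_cancel]
      rw [← h3]
      refine (h1.add h2).congr_of_eventuallyEq ?_ ?_
      · filter_upwards [self_mem_nhdsWithin, mem_nhdsWithin_of_mem_nhds (Iic_mem_nhds hs.2)]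
          with r hr hrT
        have hr' : r ∈ Icc 0 T := ⟨hs.1.trans hr, hrT⟩
        rw [Pi.add_apply, integral_sub (integrable_of_support hF hS hF0 hr' _)
          (integrable_of_support hF hS hF0 hs' _), sub_add_cancel]
      · simp) t ht
    have h6 : ∀ x, F (0, x) = ψ x := fun x => by simp [F, hB0, hb0]
    simp only [h6] at hconst
    exact hconst
  refine ⟨A, a, hA0, ha0, fun t ht => ?_⟩
  have hLt : L t = velocityLinear V (μ t) := by simp only [hLdef, hκid t ht]
  have hct : c t = velocityConst V (μ t) := by simp only [hcdef, hκid t ht]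
  refine ⟨hLt ▸ hA t ht.1, hLt ▸ hct ▸ ha t ht.1, ?_⟩
  rw [← hmap t ht, Measure.map_map (by fun_prop) (by fun_prop)]
  have h7 : (fun x => A t x + a t) ∘ (fun x => B t x + b t) = id := funext fun x => hAB t ht.1 x
  rw [h7, Measure.map_id]

end

/-! ### Dependence of the velocity on the measure -/

section
variable {d : ℕ} {V : Space d → ℝ}

theorem one_lt_of_div_le {q p : ℝ} (hq : 1 < q) (hp : q / (q - 1) ≤ p) : 1 < p :=
  lt_of_lt_of_le (by rw [one_lt_div (by linarith)]; linarith) hp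

/-- Hölder's inequality, with the conjugate exponent of `p` at most `q`, so that the corresponding
power of `(1 + V)^{1/q}` is at most `1 + V`. -/
theorem lintegral_weight_mul_le (hV : GrowthAssumption V) {Z : Type*} [MeasurableSpace Z]
    {π : Measure Z} {X : Z → Space d} (hX : Measurable X)
    (hw : Integrable (fun x => 1 + V x) (π.map X)) {B : ℝ} (hB1 : 1 ≤ B)
    (hB : ∫ x, (1 + V x) ∂(π.map X) ≤ B) {q p : ℝ} (hq : 1 < q) (hp : q / (q - 1) ≤ p)
    {g : Z → ℝ≥0∞} (hg : Measurable g) :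
    ∫⁻ z, ENNReal.ofReal ((1 + V (X z)) ^ (1 / q)) * g z ∂π
      ≤ ENNReal.ofReal B * (∫⁻ z, g z ^ p ∂π) ^ (1 / p) := by
  have hp1 := one_lt_of_div_le hq hp
  have hVc := hV.smooth.continuous
  have hw1 : ∀ x, 1 ≤ 1 + V x := fun x => by linarith [hV.nonneg x]
  have hconj := (Real.HolderConjugate.conjExponent hp1).symm
  set r := Real.conjExponent p with hr
  have hr1 : 1 < r := hconj.lt
  have hrq : r ≤ q := by
    have hp' : q ≤ p * (q - 1) := (div_le_iff₀ (by linarith)).1 hp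
    rw [hr, Real.conjExponent, div_le_iff₀ (by linarith)]
    linarith
  have hfm : Measurable fun z => ENNReal.ofReal ((1 + V (X z)) ^ (1 / q)) := by
    have : Measurable fun x => ENNReal.ofReal ((1 + V x) ^ (1 / q)) :=
      ((hVc.measurable.const_add 1).pow_const _).ennreal_ofReal
    exact this.comp hX
  refine (ENNReal.lintegral_mul_le_Lp_mul_Lq π hconj hfm.aemeasurable hg.aemeasurable).trans ?_
  gcongr
  have h1 : ∫⁻ z, ENNReal.ofReal ((1 + V (X z)) ^ (1 / q)) ^ r ∂π ≤ ENNReal.ofReal B := by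
    calc _ ≤ ∫⁻ z, ENNReal.ofReal (1 + V (X z)) ∂π := by
          refine lintegral_mono fun z => ?_
          rw [ENNReal.ofReal_rpow_of_nonneg (Real.rpow_nonneg (zero_le_one.trans (hw1 _)) _)
            (by linarith), ← Real.rpow_mul (zero_le_one.trans (hw1 _))]
          refine ENNReal.ofReal_le_ofReal ?_
          calc _ ≤ (1 + V (X z)) ^ (1 : ℝ) := by
                refine Real.rpow_le_rpow_of_exponent_le (hw1 _) ?_
                rw [one_div_mul_eq_div, div_le_one (by linarith)]
                exact hrq
            _ = _ := Real.rpow_one _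
      _ = ∫⁻ x, ENNReal.ofReal (1 + V x) ∂(π.map X) := by
          rw [lintegral_map (by fun_prop) hX]
      _ = ENNReal.ofReal (∫ x, (1 + V x) ∂(π.map X)) := by
          rw [ofReal_integral_eq_lintegral_ofReal hw
            (Eventually.of_forall fun x => zero_le_one.trans (hw1 x))]
      _ ≤ _ := ENNReal.ofReal_le_ofReal hB
  calc _ ≤ ENNReal.ofReal B ^ (1 / r) := by gcongr
    _ ≤ ENNReal.ofReal B ^ (1 : ℝ) := by
        refine ENNReal.rpow_le_rpow_of_exponent_le (by simpa using hB1) ?_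
        rw [div_le_one (by linarith)]
        exact hr1.le
    _ = _ := ENNReal.rpow_one _

/-- Means of a function whose local Lipschitz constant is of order `(1 + V)^{1/q}` depend on the
measure in a Lipschitz way, with respect to the `L^p` cost. -/
theorem enorm_integral_sub_integral_le (hV : GrowthAssumption V) {Z : Type*} [MeasurableSpace Z]
    {π : Measure Z} {X₁ X₂ : Z → Space d} (hX₁ : Measurable X₁) (hX₂ : Measurable X₂)
    (hw₁ : Integrable (fun x => 1 + V x) (π.map X₁))
    (hw₂ : Integrable (fun x => 1 + V x) (π.map X₂)) {B : ℝ} (hB1 : 1 ≤ B)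
    (hB₁ : ∫ x, (1 + V x) ∂(π.map X₁) ≤ B) (hB₂ : ∫ x, (1 + V x) ∂(π.map X₂) ≤ B)
    {q p : ℝ} (hq : 1 < q) (hp : q / (q - 1) ≤ p)
    {E : Type*} [NormedAddCommGroup E] [NormedSpace ℝ E] {G : Space d → E}
    (hG₁ : Integrable G (π.map X₁)) (hG₂ : Integrable G (π.map X₂)) {C : ℝ} (hC : 0 ≤ C)
    (hG : ∀ x y, ‖G x - G y‖ ≤ C * (((1 + V x) ^ (1 / q) + (1 + V y) ^ (1 / q)) * ‖x - y‖)) :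
    ‖(∫ x, G x ∂(π.map X₁)) - ∫ x, G x ∂(π.map X₂)‖ₑ
      ≤ ENNReal.ofReal (2 * C * B) * (∫⁻ z, ‖X₁ z - X₂ z‖ₑ ^ p ∂π) ^ (1 / p) := by
  have hVc := hV.smooth.continuous
  have hw : ∀ x, 0 ≤ 1 + V x := fun x => by linarith [hV.nonneg x]
  have hgm : Measurable fun z => ‖X₁ z - X₂ z‖ₑ := by fun_prop
  rw [integral_map hX₁.aemeasurable hG₁.aestronglyMeasurable,
    integral_map hX₂.aemeasurable hG₂.aestronglyMeasurable,
    ← integral_sub (f := fun z => G (X₁ z)) (g := fun z => G (X₂ z)) (hG₁.comp_measurable hX₁)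
      (hG₂.comp_measurable hX₂)]
  have hfm : Measurable fun z => ENNReal.ofReal ((1 + V (X₁ z)) ^ (1 / q)) := by
    have : Measurable fun x => ENNReal.ofReal ((1 + V x) ^ (1 / q)) :=
      ((hVc.measurable.const_add 1).pow_const _).ennreal_ofReal
    exact this.comp hX₁
  calc _ ≤ ∫⁻ z, ‖G (X₁ z) - G (X₂ z)‖ₑ ∂π := enorm_integral_le_lintegral_enorm _
    _ ≤ ∫⁻ z, ENNReal.ofReal C * (ENNReal.ofReal ((1 + V (X₁ z)) ^ (1 / q)) * ‖X₁ z - X₂ z‖ₑ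
          + ENNReal.ofReal ((1 + V (X₂ z)) ^ (1 / q)) * ‖X₁ z - X₂ z‖ₑ) ∂π := by
        refine lintegral_mono fun z => ?_
        rw [← ofReal_norm, ← ofReal_norm, ← add_mul,
          ← ENNReal.ofReal_add (Real.rpow_nonneg (hw _) _) (Real.rpow_nonneg (hw _) _),
          ← ENNReal.ofReal_mul (add_nonneg (Real.rpow_nonneg (hw _) _)
            (Real.rpow_nonneg (hw _) _)), ← ENNReal.ofReal_mul hC]
        exact ENNReal.ofReal_le_ofReal (hG _ _)
    _ = ENNReal.ofReal C * (∫⁻ z, ENNReal.ofReal ((1 + V (X₁ z)) ^ (1 / q)) * ‖X₁ z - X₂ z‖ₑ ∂π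
          + ∫⁻ z, ENNReal.ofReal ((1 + V (X₂ z)) ^ (1 / q)) * ‖X₁ z - X₂ z‖ₑ ∂π) := by
        have hm : Measurable fun z =>
          ENNReal.ofReal ((1 + V (X₁ z)) ^ (1 / q)) * ‖X₁ z - X₂ z‖ₑ := hfm.mul hgm
        rw [lintegral_const_mul' _ _ ENNReal.ofReal_ne_top, lintegral_add_left hm]
    _ ≤ ENNReal.ofReal C * (ENNReal.ofReal B * (∫⁻ z, ‖X₁ z - X₂ z‖ₑ ^ p ∂π) ^ (1 / p)
          + ENNReal.ofReal B * (∫⁻ z, ‖X₁ z - X₂ z‖ₑ ^ p ∂π) ^ (1 / p)) := by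
        gcongr
        · exact lintegral_weight_mul_le hV hX₁ hw₁ hB1 hB₁ hq hp hgm
        · exact lintegral_weight_mul_le hV hX₂ hw₂ hB1 hB₂ hq hp hgm
    _ = _ := by
        rw [ENNReal.ofReal_mul (by positivity), ENNReal.ofReal_mul zero_le_two,
          ENNReal.ofReal_ofNat]
        ring

/-- Lipschitz dependence of the velocity coefficients on the measure, for the transport cost of a
coupling given by `X₁` and `X₂`. -/
theorem exists_velocity_sub_le (hV : GrowthAssumption V) {q : ℝ} (hVq : IndexAssumption V q) {p : ℝ}
    (hp : q / (q - 1) ≤ p) {B : ℝ} (hB1 : 1 ≤ B) : ∃ C : ℝ, 0 < C ∧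
      ∀ {Z : Type} [MeasurableSpace Z] {π : Measure Z} {X₁ X₂ : Z → Space d} {D : ℝ},
        Measurable X₁ → Measurable X₂ →
        Integrable (fun x => 1 + V x) (π.map X₁) → Integrable (fun x => 1 + V x) (π.map X₂) →
        ∫ x, (1 + V x) ∂(π.map X₁) ≤ B → ∫ x, (1 + V x) ∂(π.map X₂) ≤ B → 0 ≤ D →
        (∫⁻ z, ‖X₁ z - X₂ z‖ₑ ^ p ∂π) ^ (1 / p) ≤ ENNReal.ofReal D →
        ‖velocityLinear V (π.map X₁) - velocityLinear V (π.map X₂)‖ ≤ C * D ∧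
        ‖velocityConst V (π.map X₁) - velocityConst V (π.map X₂)‖ ≤ C * D := by
  obtain ⟨C, hC, hlip⟩ := exists_lipschitz_gradient hV hVq
  refine ⟨2 * C * B, by positivity, fun {Z} _ {π X₁ X₂ D} hX₁ hX₂ hw₁ hw₂ hB₁ hB₂ hD0 hD => ?_⟩
  have key : ∀ {E : Type} [NormedAddCommGroup E] [NormedSpace ℝ E] {G : Space d → E},
      Integrable G (π.map X₁) → Integrable G (π.map X₂) →
      (∀ x y, ‖G x - G y‖ ≤ C * (((1 + V x) ^ (1 / q) + (1 + V y) ^ (1 / q)) * ‖x - y‖)) →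
      ‖(∫ x, G x ∂(π.map X₁)) - ∫ x, G x ∂(π.map X₂)‖ ≤ 2 * C * B * D := by
    intro E _ _ G hG₁ hG₂ hG
    have h1 := enorm_integral_sub_integral_le hV hX₁ hX₂ hw₁ hw₂ hB1 hB₁ hB₂ hVq.1 hp hG₁ hG₂
      hC.le hG
    rw [← ENNReal.ofReal_le_ofReal_iff (by positivity), ofReal_norm,
      ENNReal.ofReal_mul (by positivity)]
    exact h1.trans (by gcongr)
  refine ⟨?_, ?_⟩
  · rw [velocityLinear, velocityLinear, sub_sub_sub_cancel_left, norm_sub_rev]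
    exact key (integrable_gradientOuter hV hw₁) (integrable_gradientOuter hV hw₂)
      fun x y => (hlip x y).2
  · rw [velocityConst, velocityConst, neg_sub_neg, norm_sub_rev]
    exact key (integrable_gradient hV hw₁) (integrable_gradient hV hw₂) fun x y => (hlip x y).1

theorem integral_potential_le_of_momentNorm_le (hV : GrowthAssumption V) {p : ℝ} (hp : 0 ≤ p)
    {C : ℝ} (hC : 0 ≤ C) (hle : ∀ x, 1 + V x ≤ C * (1 + ‖x‖ ^ p)) {ρ : Measure (Space d)}
    [IsProbabilityMeasure ρ] {R : ℝ} (hR : 0 ≤ R) (hρ : momentNorm p ρ ≤ ENNReal.ofReal R) :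
    ∫ x, (1 + V x) ∂ρ ≤ C * (1 + R) := by
  have hVc := hV.smooth.continuous
  rw [integral_eq_lintegral_of_nonneg_ae (Eventually.of_forall fun x => by
    simp only [Pi.zero_apply]; linarith [hV.nonneg x]) (by fun_prop)]
  refine ENNReal.toReal_le_of_le_ofReal (by positivity) ?_
  calc _ ≤ ∫⁻ x, ENNReal.ofReal C * (1 + ‖x‖ₑ ^ p) ∂ρ := by
        refine lintegral_mono fun x => ?_
        rw [← ofReal_norm, ENNReal.ofReal_rpow_of_nonneg (norm_nonneg _) hp,
          ← ENNReal.ofReal_one, ← ENNReal.ofReal_add zero_le_one (by positivity),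
          ← ENNReal.ofReal_mul hC]
        exact ENNReal.ofReal_le_ofReal (hle x)
    _ = ENNReal.ofReal C * (1 + momentNorm p ρ) := by
        rw [lintegral_const_mul _ (by fun_prop), lintegral_add_left (by fun_prop), lintegral_const,
          measure_univ, one_mul]
        rfl
    _ ≤ ENNReal.ofReal C * (1 + ENNReal.ofReal R) := by gcongr
    _ = _ := by
        rw [← ENNReal.ofReal_one, ← ENNReal.ofReal_add zero_le_one hR, ← ENNReal.ofReal_mul hC]

/-- The transport cost of a coupling pushed forward by two affine maps. -/
theorem lintegral_affine_sub_le {p : ℝ} (hp : 1 ≤ p) {π : Measure (Space d × Space d)}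
    [IsProbabilityMeasure π] {A₁ A₂ : Space d →L[ℝ] Space d} {a₁ a₂ : Space d} {M e D R : ℝ}
    (hM : 0 ≤ M) (he : 0 ≤ e) (hD : 0 ≤ D) (hR : 0 ≤ R) (hA : ‖A₁‖ ≤ M) (hAe : ‖A₁ - A₂‖ ≤ e)
    (hae : ‖a₁ - a₂‖ ≤ e)
    (hπD : (∫⁻ z, ‖z.1 - z.2‖ₑ ^ p ∂π) ^ (1 / p) ≤ ENNReal.ofReal D)
    (hπR : ∫⁻ z, ‖z.2‖ₑ ^ p ∂π ≤ ENNReal.ofReal R) :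
    (∫⁻ z, ‖(A₁ z.1 + a₁) - (A₂ z.2 + a₂)‖ₑ ^ p ∂π) ^ (1 / p)
      ≤ ENNReal.ofReal (M * D + e * (1 + R ^ (1 / p))) := by
  have hp0 : 0 < p := by linarith
  have hscale : ∀ (c : ℝ) {g : Space d × Space d → ℝ≥0∞}, Measurable g →
      (∫⁻ z, (ENNReal.ofReal c * g z) ^ p ∂π) ^ (1 / p)
        = ENNReal.ofReal c * (∫⁻ z, g z ^ p ∂π) ^ (1 / p) := fun c g hg => by
    simp only [ENNReal.mul_rpow_of_nonneg _ _ hp0.le]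
    rw [lintegral_const_mul _ (hg.pow_const _), ENNReal.mul_rpow_of_nonneg _ _ (by positivity),
      ← ENNReal.rpow_mul, mul_one_div_cancel hp0.ne', ENNReal.rpow_one]
  have hpt : ∀ z : Space d × Space d, ‖(A₁ z.1 + a₁) - (A₂ z.2 + a₂)‖ₑ
      ≤ ENNReal.ofReal M * ‖z.1 - z.2‖ₑ + ENNReal.ofReal e * (1 + ‖z.2‖ₑ) := by
    intro z
    rw [← ofReal_norm, ← ofReal_norm, ← ofReal_norm,
      ← ENNReal.ofReal_one, ← ENNReal.ofReal_add zero_le_one (norm_nonneg _),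
      ← ENNReal.ofReal_mul hM, ← ENNReal.ofReal_mul he,
      ← ENNReal.ofReal_add (by positivity) (by positivity)]
    refine ENNReal.ofReal_le_ofReal ?_
    have h1 : (A₁ z.1 + a₁) - (A₂ z.2 + a₂) = A₁ (z.1 - z.2) + ((A₁ - A₂) z.2 + (a₁ - a₂)) := by
      simp only [map_sub, sub_apply]; abel
    rw [h1]
    calc _ ≤ ‖A₁ (z.1 - z.2)‖ + (‖(A₁ - A₂) z.2‖ + ‖a₁ - a₂‖) :=
          (norm_add_le _ _).trans (add_le_add_right (norm_add_le _ _) _)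
      _ ≤ M * ‖z.1 - z.2‖ + (e * ‖z.2‖ + e) := by
          gcongr
          · exact (A₁.le_opNorm _).trans (by gcongr)
          · exact ((A₁ - A₂).le_opNorm _).trans (by gcongr)
      _ = _ := by ring
  have hR' : (∫⁻ z : Space d × Space d, (1 + ‖z.2‖ₑ) ^ p ∂π) ^ (1 / p)
      ≤ ENNReal.ofReal (1 + R ^ (1 / p)) := by
    refine (ENNReal.lintegral_Lp_add_le (μ := π) (f := fun _ => (1 : ℝ≥0∞))
      (g := fun z : Space d × Space d => ‖z.2‖ₑ) (by fun_prop) (by fun_prop) hp).trans ?_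
    simp only [ENNReal.one_rpow, lintegral_const, measure_univ, one_mul]
    rw [ENNReal.ofReal_add zero_le_one (by positivity), ENNReal.ofReal_one,
      ← ENNReal.ofReal_rpow_of_nonneg hR (by positivity)]
    gcongr
  let f : Space d × Space d → ℝ≥0∞ := fun z => ENNReal.ofReal M * ‖z.1 - z.2‖ₑ
  let g : Space d × Space d → ℝ≥0∞ := fun z => ENNReal.ofReal e * (1 + ‖z.2‖ₑ)
  calc _ ≤ (∫⁻ z, (f + g) z ^ p ∂π) ^ (1 / p) := by
        gcongr with z
        exact hpt z
    _ ≤ (∫⁻ z, f z ^ p ∂π) ^ (1 / p) + (∫⁻ z, g z ^ p ∂π) ^ (1 / p) :=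
        ENNReal.lintegral_Lp_add_le (by fun_prop) (by fun_prop) hp
    _ ≤ ENNReal.ofReal M * ENNReal.ofReal D
          + ENNReal.ofReal e * ENNReal.ofReal (1 + R ^ (1 / p)) := by
        simp only [f, g]
        rw [hscale M (by fun_prop), hscale e (by fun_prop)]
        gcongr
    _ = _ := by
        rw [← ENNReal.ofReal_mul hM, ← ENNReal.ofReal_mul he,
          ← ENNReal.ofReal_add (by positivity) (by positivity)]

end

/-! ### Stability -/

section
variable {d : ℕ} {V : Space d → ℝ}

/-- A bound on `∫ (1 + V) dμ_t` that depends on the solution only through the moment of the initial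
condition. -/
theorem exists_integral_potential_le (hV : GrowthAssumption V) {q : ℝ} (hVq : IndexAssumption V q)
    {p : ℝ} (hp : q / (q - 1) ≤ p) {R T : ℝ} (hR : 0 ≤ R) : ∃ B : ℝ, 1 ≤ B ∧
      ∀ (ν : Measure (Space d)) (μ : ℝ → ProbabilityMeasure (Space d)),
        momentNorm p ν ≤ ENNReal.ofReal R → IsWeakSolution V ν μ → ∀ t ∈ Icc 0 T,
          ∫ x, (1 + V x) ∂(μ t : Measure (Space d)) ≤ B := by
  obtain ⟨C₁, hC₁, h1⟩ := hV.exists_gradient_le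
  obtain ⟨C₂, hC₂, h2⟩ := exists_le_moment hV hVq hp
  have hp0 : 0 ≤ p := (zero_lt_one.trans (one_lt_of_div_le hVq.1 hp)).le
  refine ⟨max 1 (C₂ * (1 + R) * Real.exp (C₁ * T)), le_max_left _ _, fun ν μ hν h t ht => ?_⟩
  refine le_trans ?_ (le_max_right _ _)
  refine (h.integral_potential_le hV h1 ht.1).trans ?_
  rw [← h.initial] at hν
  gcongr
  · exact integral_potential_le_of_momentNorm_le hV hp0 hC₂.le h2 hR hν
  · exact ht.2

/-- Gronwall's lemma for the flow of a bounded affine field. -/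
theorem norm_affine_flow_le {L A : ℝ → Space d →L[ℝ] Space d} {c a : ℝ → Space d} {K T : ℝ}
    (hK : 1 ≤ K) (hA0 : A 0 = 1) (ha0 : a 0 = 0)
    (hA : ∀ t ∈ Icc 0 T, HasDerivAt A (L t * A t) t)
    (ha : ∀ t ∈ Icc 0 T, HasDerivAt a (L t (a t) + c t) t)
    (hL : ∀ t ∈ Icc 0 T, ‖L t‖ ≤ K) (hc : ∀ t ∈ Icc 0 T, ‖c t‖ ≤ K) {t : ℝ} (ht : t ∈ Icc 0 T) :
    ‖A t‖ ≤ Real.exp (K * T) ∧ ‖a t‖ ≤ Real.exp (K * T) := by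
  have hK0 : 0 < K := by linarith
  have hexp : Real.exp (K * t) ≤ Real.exp (K * T) := by gcongr; exact ht.2
  constructor
  · have h1 := norm_le_gronwallBound_of_norm_deriv_right_le (f := A) (f' := fun s => L s * A s)
      (δ := 1) (K := K) (ε := 0) (a := 0) (b := T)
      (fun s hs => (hA s hs).continuousAt.continuousWithinAt)
      (fun s hs => (hA s ⟨hs.1, hs.2.le⟩).hasDerivWithinAt)
      (by rw [hA0]; exact ContinuousLinearMap.norm_id_le)
      (fun s hs => by
        rw [add_zero]
        refine (norm_mul_le _ _).trans ?_
        gcongr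
        exact hL s ⟨hs.1, hs.2.le⟩) t ht
    rw [gronwallBound_ε0, sub_zero, one_mul] at h1
    exact h1.trans hexp
  · have h1 := norm_le_gronwallBound_of_norm_deriv_right_le (f := a)
      (f' := fun s => L s (a s) + c s) (δ := 0) (K := K) (ε := K) (a := 0) (b := T)
      (fun s hs => (ha s hs).continuousAt.continuousWithinAt)
      (fun s hs => (ha s ⟨hs.1, hs.2.le⟩).hasDerivWithinAt)
      (by rw [ha0, norm_zero])
      (fun s hs => by
        have hs' : s ∈ Icc 0 T := ⟨hs.1, hs.2.le⟩
        refine (norm_add_le _ _).trans (add_le_add (((L s).le_opNorm _).trans ?_) (hc s hs'))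
        gcongr
        exact hL s hs') t ht
    simp only [gronwallBound_of_K_ne_0 hK0.ne', sub_zero, zero_mul, zero_add, div_self hK0.ne',
      one_mul] at h1
    linarith

/-- Stability along one coupling `π` of the initial conditions: the coupling is transported by the
two affine flows, and the distance of the flows is controlled by Gronwall's lemma. -/
theorem exists_wasserstein_le_of_coupling (hV : GrowthAssumption V) {q : ℝ}
    (hVq : IndexAssumption V q) {p : ℝ} (hp : q / (q - 1) ≤ p) {R T : ℝ} (hR : 0 < R)
    (hT : 0 < T) : ∃ C : ℝ, 0 < C ∧
      ∀ (ν₁ ν₂ : Measure (Space d)) (μ₁ μ₂ : ℝ → ProbabilityMeasure (Space d)),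
        momentNorm p ν₁ ≤ ENNReal.ofReal R → momentNorm p ν₂ ≤ ENNReal.ofReal R →
        IsWeakSolution V ν₁ μ₁ → IsWeakSolution V ν₂ μ₂ → ∀ π ∈ couplings ν₁ ν₂,
        ∀ t ∈ Icc 0 T, wasserstein p (μ₁ t : Measure (Space d)) (μ₂ t)
          ≤ ENNReal.ofReal C * (∫⁻ z, ‖z.1 - z.2‖ₑ ^ p ∂π) ^ (1 / p) := by
  have hp1 := one_lt_of_div_le hVq.1 hp
  have hp0 : 0 < p := by linarith
  obtain ⟨B, hB1, hB⟩ := exists_integral_potential_le hV hVq hp hR.le (T := T)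
  obtain ⟨C₁, hC₁, hgrad⟩ := hV.exists_gradient_bounds
  obtain ⟨C₂, hC₂, hvel⟩ := exists_velocity_sub_le hV hVq hp hB1
  -- `K` bounds the coefficients of the velocities, `M` those of the flows, and `r` the `L^p` norm of
  -- `1 + ‖x‖`; `K'` and `Q` come from Gronwall's lemma for the difference of the flows
  set K : ℝ := 1 + C₁ * B with hKdef
  have hB0 : 0 < B := by linarith
  have hK1 : 1 ≤ K := by rw [hKdef]; linarith [mul_pos hC₁ hB0]
  set M : ℝ := Real.exp (K * T) with hMdef
  have hM : 0 < M := Real.exp_pos _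
  set r : ℝ := 1 + R ^ (1 / p) with hrdef
  have hr : 0 < r := by positivity
  set K' : ℝ := K + C₂ * r * (M + 1) with hK'def
  have hK' : 0 < K' := by positivity
  set Q : ℝ := C₂ * M * (M + 1) / K' * Real.exp (K' * T) with hQdef
  have hQ : 0 < Q := by positivity
  refine ⟨M + Q * r, by positivity, fun ν₁ ν₂ μ₁ μ₂ hν₁ hν₂ h₁ h₂ π hπ t ht => ?_⟩
  have hB₁ := hB ν₁ μ₁ hν₁ h₁
  have hB₂ := hB ν₂ μ₂ hν₂ h₂
  rcases eq_or_ne ((∫⁻ z, ‖z.1 - z.2‖ₑ ^ p ∂π) ^ (1 / p)) ⊤ with htop | htop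
  · rw [htop, ENNReal.mul_top (by simp; positivity)]
    exact le_top
  set D : ℝ := ((∫⁻ z, ‖z.1 - z.2‖ₑ ^ p ∂π) ^ (1 / p)).toReal with hDdef
  have hD0 : 0 ≤ D := ENNReal.toReal_nonneg
  have hD : (∫⁻ z, ‖z.1 - z.2‖ₑ ^ p ∂π) ^ (1 / p) = ENNReal.ofReal D :=
    (ENNReal.ofReal_toReal htop).symm
  obtain ⟨hπ₁, hπ₂⟩ := hπ
  rw [← h₁.initial] at hπ₁
  rw [← h₂.initial] at hπ₂ hν₂
  have hπprob : IsProbabilityMeasure π := by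
    have : IsProbabilityMeasure (π.map Prod.fst) := by rw [hπ₁]; infer_instance
    exact Measure.isProbabilityMeasure_of_map Prod.fst
  obtain ⟨A₁, a₁, hA₁0, ha₁0, hf₁⟩ := h₁.exists_flow hV hT
  obtain ⟨A₂, a₂, hA₂0, ha₂0, hf₂⟩ := h₂.exists_flow hV hT
  have hint₁ : ∀ s ∈ Icc 0 T, Integrable (fun x => 1 + V x) (μ₁ s : Measure (Space d)) :=
    fun s hs => h₁.integrable hV hs.1
  have hint₂ : ∀ s ∈ Icc 0 T, Integrable (fun x => 1 + V x) (μ₂ s : Measure (Space d)) :=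
    fun s hs => h₂.integrable hV hs.1
  have hLK : ∀ {ρ : Measure (Space d)}, Integrable (fun x => 1 + V x) ρ →
      ∫ x, (1 + V x) ∂ρ ≤ B → ‖velocityLinear V ρ‖ ≤ K ∧ ‖velocityConst V ρ‖ ≤ K := by
    intro ρ hw hρ
    have h3 : C₁ * ∫ x, (1 + V x) ∂ρ ≤ C₁ * B := by gcongr
    exact ⟨(norm_velocityLinear_le hw fun x => (hgrad x).2.2).trans (by linarith),
      (norm_velocityConst_le hw fun x => (hgrad x).2.1).trans (by linarith)⟩
  have hM₁ : ∀ s ∈ Icc 0 T, ‖A₁ s‖ ≤ M ∧ ‖a₁ s‖ ≤ M := fun s hs =>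
    norm_affine_flow_le hK1 hA₁0 ha₁0 (fun s hs => (hf₁ s hs).1) (fun s hs => (hf₁ s hs).2.1)
      (fun s hs => (hLK (hint₁ s hs) (hB₁ s hs)).1) (fun s hs => (hLK (hint₁ s hs) (hB₁ s hs)).2) hs
  have hM₂ : ∀ s ∈ Icc 0 T, ‖A₂ s‖ ≤ M ∧ ‖a₂ s‖ ≤ M := fun s hs =>
    norm_affine_flow_le hK1 hA₂0 ha₂0 (fun s hs => (hf₂ s hs).1) (fun s hs => (hf₂ s hs).2.1)
      (fun s hs => (hLK (hint₂ s hs) (hB₂ s hs)).1) (fun s hs => (hLK (hint₂ s hs) (hB₂ s hs)).2) hs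
  have hπR : ∫⁻ z, ‖z.2‖ₑ ^ p ∂π ≤ ENNReal.ofReal R := by
    rw [← hπ₂, momentNorm, lintegral_map (by fun_prop) measurable_snd] at hν₂
    exact hν₂
  -- the difference of the two flows, in the product norm
  let Y : ℝ → (Space d →L[ℝ] Space d) × Space d := fun s => (A₁ s - A₂ s, a₁ s - a₂ s)
  have hcost : ∀ s ∈ Icc 0 T,
      (∫⁻ z, ‖(A₁ s z.1 + a₁ s) - (A₂ s z.2 + a₂ s)‖ₑ ^ p ∂π) ^ (1 / p)
        ≤ ENNReal.ofReal (M * D + ‖Y s‖ * r) := fun s hs =>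
    lintegral_affine_sub_le hp1.le hM.le (norm_nonneg (Y s)) hD0 hR.le (hM₁ s hs).1
      (norm_fst_le (Y s)) (norm_snd_le (Y s)) hD.le hπR
  let X₁ : ℝ → Space d × Space d → Space d := fun s z => A₁ s z.1 + a₁ s
  let X₂ : ℝ → Space d × Space d → Space d := fun s z => A₂ s z.2 + a₂ s
  have hX₁m : ∀ s, Measurable (X₁ s) := fun s => by fun_prop
  have hX₂m : ∀ s, Measurable (X₂ s) := fun s => by fun_prop
  have hX₁ : ∀ s ∈ Icc 0 T, π.map (X₁ s) = (μ₁ s : Measure (Space d)) := fun s hs => by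
    rw [(hf₁ s hs).2.2, ← hπ₁, Measure.map_map (by fun_prop) measurable_fst]
    rfl
  have hX₂ : ∀ s ∈ Icc 0 T, π.map (X₂ s) = (μ₂ s : Measure (Space d)) := fun s hs => by
    rw [(hf₂ s hs).2.2, ← hπ₂, Measure.map_map (by fun_prop) measurable_snd]
    rfl
  have hδ : ∀ s ∈ Icc 0 T,
      ‖velocityLinear V (μ₁ s) - velocityLinear V (μ₂ s)‖ ≤ C₂ * (M * D + ‖Y s‖ * r) ∧
      ‖velocityConst V (μ₁ s) - velocityConst V (μ₂ s)‖ ≤ C₂ * (M * D + ‖Y s‖ * r) := by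
    intro s hs
    have := hvel (π := π) (D := M * D + ‖Y s‖ * r) (hX₁m s) (hX₂m s)
      (by rw [hX₁ s hs]; exact hint₁ s hs) (by rw [hX₂ s hs]; exact hint₂ s hs)
      (by rw [hX₁ s hs]; exact hB₁ s hs) (by rw [hX₂ s hs]; exact hB₂ s hs) (by positivity)
      (hcost s hs)
    rwa [hX₁ s hs, hX₂ s hs] at this
  have hYd : ∀ s ∈ Icc 0 T, HasDerivAt Y (velocityLinear V (μ₁ s) * A₁ s
      - velocityLinear V (μ₂ s) * A₂ s, (velocityLinear V (μ₁ s) (a₁ s) + velocityConst V (μ₁ s))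
      - (velocityLinear V (μ₂ s) (a₂ s) + velocityConst V (μ₂ s))) s := fun s hs =>
    ((hf₁ s hs).1.sub (hf₂ s hs).1).prodMk ((hf₁ s hs).2.1.sub (hf₂ s hs).2.1)
  have hYle : ∀ s ∈ Icc 0 T, ‖Y s‖ ≤ Q * D := by
    intro s hs
    have h4 := norm_le_gronwallBound_of_norm_deriv_right_le (f := Y) (δ := 0) (K := K')
      (ε := C₂ * M * (M + 1) * D) (a := 0) (b := T)
      (fun s hs => (hYd s hs).continuousAt.continuousWithinAt)
      (fun s hs => (hYd s ⟨hs.1, hs.2.le⟩).hasDerivWithinAt)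
      (by simp [Y, hA₁0, hA₂0, ha₁0, ha₂0])
      (fun s hs => by
        have hs' : s ∈ Icc 0 T := ⟨hs.1, hs.2.le⟩
        obtain ⟨hδ1, hδ2⟩ := hδ s hs'
        have hL₁ := (hLK (hint₁ s hs') (hB₁ s hs')).1
        have hY1 : ‖A₁ s - A₂ s‖ ≤ ‖Y s‖ := norm_fst_le (Y s)
        have hY2 : ‖a₁ s - a₂ s‖ ≤ ‖Y s‖ := norm_snd_le (Y s)
        have hδ0 : 0 ≤ C₂ * (M * D + ‖Y s‖ * r) := (norm_nonneg _).trans hδ1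
        have hgoal : K * ‖Y s‖ + C₂ * (M * D + ‖Y s‖ * r) * (M + 1)
            = K' * ‖Y s‖ + C₂ * M * (M + 1) * D := by rw [hK'def]; ring
        rw [← hgoal, Prod.norm_def]
        refine max_le ?_ ?_
        · have e1 : velocityLinear V (μ₁ s) * A₁ s - velocityLinear V (μ₂ s) * A₂ s
              = velocityLinear V (μ₁ s) * (A₁ s - A₂ s)
                + (velocityLinear V (μ₁ s) - velocityLinear V (μ₂ s)) * A₂ s := by
            rw [mul_sub, sub_mul]; abel
          simp only [e1]
          calc _ ≤ K * ‖Y s‖ + C₂ * (M * D + ‖Y s‖ * r) * M := by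
                refine (norm_add_le _ _).trans (add_le_add ((norm_mul_le _ _).trans ?_)
                  ((norm_mul_le _ _).trans ?_))
                · gcongr
                · gcongr
                  exact (hM₂ s hs').1
            _ ≤ _ := by linarith
        · have e2 : (velocityLinear V (μ₁ s) (a₁ s) + velocityConst V (μ₁ s))
              - (velocityLinear V (μ₂ s) (a₂ s) + velocityConst V (μ₂ s))
              = velocityLinear V (μ₁ s) (a₁ s - a₂ s)
                + (velocityLinear V (μ₁ s) - velocityLinear V (μ₂ s)) (a₂ s)
                + (velocityConst V (μ₁ s) - velocityConst V (μ₂ s)) := by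
            simp only [map_sub, sub_apply]; abel
          simp only [e2]
          calc _ ≤ K * ‖Y s‖ + C₂ * (M * D + ‖Y s‖ * r) * M + C₂ * (M * D + ‖Y s‖ * r) := by
                refine (norm_add_le _ _).trans (add_le_add ((norm_add_le _ _).trans (add_le_add
                  ((ContinuousLinearMap.le_opNorm _ _).trans ?_)
                  ((ContinuousLinearMap.le_opNorm _ _).trans ?_))) hδ2)
                · gcongr
                · gcongr
                  exact (hM₂ s hs').2
            _ = _ := by ring) s hs
    simp only [gronwallBound_of_K_ne_0 hK'.ne', sub_zero, zero_mul, zero_add] at h4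
    have h5 : Real.exp (K' * s) ≤ Real.exp (K' * T) := by gcongr; exact hs.2
    calc ‖Y s‖ ≤ C₂ * M * (M + 1) * D / K' * (Real.exp (K' * s) - 1) := h4
      _ ≤ C₂ * M * (M + 1) * D / K' * Real.exp (K' * T) := by gcongr; linarith
      _ = Q * D := by rw [hQdef]; ring
  have hmem : π.map (fun z => (X₁ t z, X₂ t z)) ∈ couplings (μ₁ t : Measure (Space d)) (μ₂ t) := by
    refine ⟨?_, ?_⟩
    · rw [Measure.map_map measurable_fst ((hX₁m t).prodMk (hX₂m t)), ← hX₁ t ht]; rfl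
    · rw [Measure.map_map measurable_snd ((hX₁m t).prodMk (hX₂m t)), ← hX₂ t ht]; rfl
  calc wasserstein p (μ₁ t : Measure (Space d)) (μ₂ t)
      ≤ (∫⁻ z, ‖z.1 - z.2‖ₑ ^ p ∂(π.map fun z => (X₁ t z, X₂ t z))) ^ (1 / p) := by
        rw [wasserstein]
        gcongr
        exact iInf₂_le _ hmem
    _ = (∫⁻ z, ‖X₁ t z - X₂ t z‖ₑ ^ p ∂π) ^ (1 / p) := by
        rw [lintegral_map (by fun_prop) ((hX₁m t).prodMk (hX₂m t))]
    _ ≤ ENNReal.ofReal (M * D + ‖Y t‖ * r) := hcost t ht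
    _ ≤ ENNReal.ofReal ((M + Q * r) * D) := by
        refine ENNReal.ofReal_le_ofReal ?_
        have := mul_le_mul_of_nonneg_right (hYle t ht) hr.le
        linarith
    _ = _ := by rw [ENNReal.ofReal_mul (by positivity), hD]

/-- A bound along every coupling is a bound by the Wasserstein distance. -/
theorem le_mul_wasserstein {p : ℝ} (hp : 0 < p) {ν₁ ν₂ : Measure (Space d)} {w C : ℝ≥0∞}
    (hC0 : C ≠ 0) (hC : C ≠ ⊤)
    (h : ∀ π ∈ couplings ν₁ ν₂, w ≤ C * (∫⁻ z, ‖z.1 - z.2‖ₑ ^ p ∂π) ^ (1 / p)) :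
    w ≤ C * wasserstein p ν₁ ν₂ := by
  rw [mul_comm, ← ENNReal.div_le_iff hC0 hC, wasserstein, one_div, ENNReal.le_rpow_inv_iff hp]
  refine le_iInf₂ fun π hπ => ?_
  rw [← ENNReal.le_rpow_inv_iff hp, ENNReal.div_le_iff hC0 hC, mul_comm, ← one_div]
  exact h π hπ

theorem exists_iSup_wasserstein_le (hV : GrowthAssumption V) {q : ℝ}
    (hVq : IndexAssumption V q) {p : ℝ} (hp : q / (q - 1) ≤ p) {R T : ℝ} (hR : 0 < R)
    (hT : 0 < T) : ∃ C : ℝ, 0 < C ∧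
      ∀ (ν₁ ν₂ : Measure (Space d)) (μ₁ μ₂ : ℝ → ProbabilityMeasure (Space d)),
        momentNorm p ν₁ ≤ ENNReal.ofReal R → momentNorm p ν₂ ≤ ENNReal.ofReal R →
        IsWeakSolution V ν₁ μ₁ → IsWeakSolution V ν₂ μ₂ →
        (⨆ t ∈ Icc (0 : ℝ) T, wasserstein p (μ₁ t : Measure (Space d)) (μ₂ t))
          ≤ ENNReal.ofReal C * wasserstein p ν₁ ν₂ := by
  have hp0 : 0 < p := zero_lt_one.trans (one_lt_of_div_le hVq.1 hp)
  obtain ⟨C, hC, h⟩ := exists_wasserstein_le_of_coupling hV hVq hp hR hT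
  refine ⟨C, hC, fun ν₁ ν₂ μ₁ μ₂ hν₁ hν₂ h₁ h₂ => iSup₂_le fun t ht => ?_⟩
  exact le_mul_wasserstein hp0 (by simpa using hC) ENNReal.ofReal_ne_top
    fun π hπ => h ν₁ ν₂ μ₁ μ₂ hν₁ hν₂ h₁ h₂ π hπ t ht

/-- Some coupling has cost less than one, which bounds the moment of one marginal by that of the
other. -/
theorem momentNorm_le_of_wasserstein_lt_one {p : ℝ} (hp : 1 ≤ p) {ν₁ ν₂ : Measure (Space d)}
    (h : wasserstein p ν₁ ν₂ < 1) :
    momentNorm p ν₁ ≤ 2 ^ (p - 1) * (1 + momentNorm p ν₂) := by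
  have hp0 : 0 < p := by linarith
  rw [wasserstein, one_div, ENNReal.rpow_inv_lt_iff hp0, ENNReal.one_rpow] at h
  simp only [iInf_lt_iff] at h
  obtain ⟨π, ⟨h₁, h₂⟩, hπ⟩ := h
  rw [momentNorm, momentNorm, ← h₁, ← h₂, lintegral_map (by fun_prop) measurable_fst,
    lintegral_map (by fun_prop) measurable_snd]
  calc _ ≤ ∫⁻ z, 2 ^ (p - 1) * (‖z.1 - z.2‖ₑ ^ p + ‖z.2‖ₑ ^ p) ∂π := by
        refine lintegral_mono fun z => ?_
        refine le_trans ?_ (ENNReal.rpow_add_le_mul_rpow_add_rpow _ _ hp)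
        gcongr
        calc ‖z.1‖ₑ = ‖(z.1 - z.2) + z.2‖ₑ := by rw [sub_add_cancel]
          _ ≤ _ := enorm_add_le _ _
    _ = 2 ^ (p - 1) * (∫⁻ z, ‖z.1 - z.2‖ₑ ^ p ∂π + ∫⁻ z, ‖z.2‖ₑ ^ p ∂π) := by
        rw [lintegral_const_mul _ (by fun_prop), lintegral_add_left (by fun_prop)]
    _ ≤ _ := by gcongr

end

end SVGD

theorem mainTheorem11 {d : ℕ} (V : SVGD.Space d → ℝ) (hV : SVGD.GrowthAssumption V)
    (q : ℝ) (hVq : SVGD.IndexAssumption V q) (p : ℝ) (hp : q / (q - 1) ≤ p) :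
    (∀ R T : ℝ, 0 < R → 0 < T → ∃ C : ℝ, 0 < C ∧
      ∀ (ν₁ ν₂ : ProbabilityMeasure (SVGD.Space d))
        (μ₁ μ₂ : ℝ → ProbabilityMeasure (SVGD.Space d)),
        SVGD.momentNorm (d := d) p ν₁ ≤ ENNReal.ofReal R →
        SVGD.momentNorm (d := d) p ν₂ ≤ ENNReal.ofReal R →
        SVGD.IsWeakSolution V ν₁ μ₁ → SVGD.IsWeakSolution V ν₂ μ₂ →
        (⨆ t ∈ Icc (0 : ℝ) T, SVGD.wasserstein (d := d) p (μ₁ t) (μ₂ t))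
          ≤ ENNReal.ofReal C * SVGD.wasserstein (d := d) p ν₁ ν₂) ∧
    (∀ (ν : ProbabilityMeasure (SVGD.Space d)) (μ : ℝ → ProbabilityMeasure (SVGD.Space d))
      (N : ℕ → ℕ) (x : (n : ℕ) → Fin (N n) → SVGD.Space d)
      (μN : ℕ → ℝ → ProbabilityMeasure (SVGD.Space d)),
      SVGD.momentNorm (d := d) p ν < ⊤ →
      (∀ n, 0 < N n) →
      SVGD.IsWeakSolution V ν μ →
      (∀ n, SVGD.IsWeakSolution V (SVGD.empiricalMeasure (x n)) (μN n)) →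
      Tendsto (fun n => SVGD.wasserstein p (SVGD.empiricalMeasure (x n)) ν) atTop (𝓝 0) →
      ∀ T : ℝ, 0 < T →
        Tendsto (fun n => ⨆ t ∈ Icc (0 : ℝ) T, SVGD.wasserstein (d := d) p (μN n t) (μ t))
          atTop (𝓝 0)) := by
  refine ⟨fun R T hR hT => ?_, fun ν μ N x μN hν _ hμ hμN hlim T hT => ?_⟩
  · obtain ⟨C, hC, h⟩ := SVGD.exists_iSup_wasserstein_le hV hVq hp hR hT
    exact ⟨C, hC, fun ν₁ ν₂ μ₁ μ₂ => h ν₁ ν₂ μ₁ μ₂⟩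
  · have hp1 := SVGD.one_lt_of_div_le hVq.1 hp
    -- a bound on the moments of `ν` and of all empirical measures at distance less than one
    set b : ℝ≥0∞ := 2 ^ (p - 1) * (1 + SVGD.momentNorm (d := d) p ν) with hb
    have h2 : (1 : ℝ≥0∞) ≤ 2 ^ (p - 1) := ENNReal.one_le_rpow one_le_two (by linarith)
    have hbtop : b ≠ ⊤ := ENNReal.mul_ne_top
      (ENNReal.rpow_ne_top_of_nonneg (by linarith) (by simp))
      (ENNReal.add_ne_top.2 ⟨by simp, hν.ne⟩)
    have hνb : SVGD.momentNorm (d := d) p ν ≤ b :=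
      le_add_self.trans (le_mul_of_one_le_left' h2)
    have hbR : b ≤ ENNReal.ofReal (b.toReal + 1) := by
      rw [← ENNReal.ofReal_toReal hbtop, ENNReal.toReal_ofReal ENNReal.toReal_nonneg]
      exact ENNReal.ofReal_le_ofReal (by linarith)
    obtain ⟨C, -, h⟩ := SVGD.exists_iSup_wasserstein_le hV hVq hp
      (R := b.toReal + 1) (by positivity) hT
    have hlim' := ENNReal.Tendsto.const_mul (a := ENNReal.ofReal C) hlim
      (Or.inr ENNReal.ofReal_ne_top)
    rw [mul_zero] at hlim'
    refine tendsto_of_tendsto_of_tendsto_of_le_of_le' tendsto_const_nhds hlim'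
      (Eventually.of_forall fun n => zero_le) ?_
    filter_upwards [hlim.eventually (gt_mem_nhds one_pos)] with n hn
    exact h _ _ _ _ ((SVGD.momentNorm_le_of_wasserstein_lt_one hp1.le hn).trans hbR)
      (hνb.trans hbR) (hμN n) hμ
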